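/- An $N$-function is a nonnegative even convex function $\Phi:\mathbb R\to\mathbb R$ with $\Phi(x)=0$ iff $x=0$, $\lim_{x\to0}\Phi(x)/x=0$ and $\lim_{x\to\infty}\Phi(x)/x=\infty$; its complementary $N$-function is $\Psi(y)=\sup\{x|y|-\Phi(x):x\ge0\}$. An $N$-function $\Phi$ satisfies condition (A) if $\int_0^1\Phi(v)\,v^{-2}\,dv<\infty$. Let $\mathbb H^2$ be the hyperbolic plane, modelled as $\mathbb R^2$ with coordinates $(y,z)$ and the Riemannian metric $ds^2=e^{2z}dy^2+dz^2$. For an $N$-function $\Phi$ let $L^{\Phi}(\mathbb H^2,\Lambda^k)$ be the space of measurable $k$-forms $\omega$ (modulo equality almost everywhere) with $\int_{\mathbb H^2}\Phi(a|\omega|)\,dA<\infty$ for some $a>0$, normed by $\|\omega\|_{(\Phi)}=\inf\{K>0:\int_{\mathbb H^2}\Phi(|\omega|/K)\,dA\le1\}$, where $|\omega|$ and $dA$ are the pointwise length and the area element of the metric. For $N$-functions $\Phi_1,\Phi_2$, with $d$ the weak exterior differential, put $$Z^1_{\Phi_2}=\{\omega\in L^{\Phi_2}(\mathbb H^2,\Lambda^1):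 d\omega=0\},\qquad B^1_{\Phi_1,\Phi_2}=\{\omega\in L^{\Phi_2}(\mathbb H^2,\Lambda^1):\omega=d\beta\text{ for some }\beta\in L^{\Phi_1}(\mathbb H^2,\Lambda^0)\},$$ and let $\overline H^1_{\Phi_1,\Phi_2}(\mathbb H^2)=Z^1_{\Phi_2}/\overline{B}^1_{\Phi_1,\Phi_2}$ be the reduced first $L_{\Phi_1,\Phi_2}$-cohomology, the closure being taken in $L^{\Phi_2}(\mathbb H^2,\Lambda^1)$. **Theorem.** Let $\Phi_1,\Phi_2$ be $N$-functions with complementary $N$-functions $\Psi_1,\Psi_2$. If $\Psi_1$, $\Psi_2$ and $\Phi_2$ satisfy condition (A), then $$\dim\overline H^1_{\Phi_1,\Phi_2}(\mathbb H^2)=\infty.$$ -/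

import Mathlib

open MeasureTheory Set Filter Topology
open scoped ENNReal

set_option linter.unusedSectionVars false

noncomputable section

/-! ## N-functions -/

/-- An `N`-function: a nonnegative, even, convex function `Φ : ℝ → ℝ` vanishing exactly at `0`,
with `Φ x / x → 0` as `x → 0` and `Φ x / x → ∞` as `x → ∞`. -/
structure NFunction where
  toFun : ℝ → ℝ
  nonneg' : ∀ x, 0 ≤ toFun x
  even' : ∀ x, toFun (-x) = toFun x
  convex' : ConvexOn ℝ univ toFun
  eq_zero_iff' : ∀ x, toFun x = 0 ↔ x = 0
  tendsto_zero' : Tendsto (fun x => toFun x / x) (𝓝[≠] 0) (𝓝 0)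
  tendsto_atTop' : Tendsto (fun x => toFun x / x) atTop atTop

namespace NFunction

instance : CoeFun NFunction (fun _ => ℝ → ℝ) := ⟨NFunction.toFun⟩

theorem map_zero (Φ : NFunction) : Φ 0 = 0 := (Φ.eq_zero_iff' 0).2 rfl

theorem le_scale (Φ : NFunction) {t : ℝ} (h0 : 0 ≤ t) (h1 : t ≤ 1) (x : ℝ) :
    Φ (t * x) ≤ t * Φ x := by
  have h := Φ.convex'.2 (mem_univ x) (mem_univ 0) h0 (sub_nonneg.2 h1) (by ring)
  simpa [Φ.map_zero] using h

theorem mono (Φ : NFunction) {x y : ℝ} (hx : 0 ≤ x) (hxy : x ≤ y) : Φ x ≤ Φ y := by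
  rcases hx.eq_or_lt with rfl | hx
  · rw [Φ.map_zero]; exact Φ.nonneg' y
  · have hy : 0 < y := hx.trans_le hxy
    have h := Φ.le_scale (div_nonneg hx.le hy.le) ((div_le_one hy).2 hxy) y
    rw [div_mul_cancel₀ _ hy.ne'] at h
    exact h.trans (mul_le_of_le_one_left (Φ.nonneg' y) ((div_le_one hy).2 hxy))

theorem continuous (Φ : NFunction) : Continuous Φ :=
  continuousOn_univ.1 (Φ.convex'.continuousOn isOpen_univ)

/-- The values `x |y| - Φ x`, `x ≥ 0`, whose supremum is the complementary function at `y`. -/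
def conjSet (Φ : NFunction) (y : ℝ) : Set ℝ := {s | ∃ x : ℝ, 0 ≤ x ∧ s = x * |y| - Φ x}

theorem conjSet_bddAbove (Φ : NFunction) (y : ℝ) : BddAbove (Φ.conjSet y) := by
  obtain ⟨M, hM⟩ := (Φ.tendsto_atTop'.eventually_ge_atTop |y|).exists_forall_of_atTop
  refine ⟨max M 1 * |y|, ?_⟩
  rintro _ ⟨x, hx, rfl⟩
  rcases le_total x (max M 1) with h | h
  · have := Φ.nonneg' x
    have := mul_le_mul_of_nonneg_right h (abs_nonneg y)
    linarith
  · have hx0 : 0 < x := lt_of_lt_of_le one_pos ((le_max_right _ _).trans h)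
    have h1 := hM x ((le_max_left _ _).trans h)
    rw [le_div_iff₀ hx0] at h1
    have : 0 ≤ max M 1 * |y| := by positivity
    linarith [mul_comm x |y|]

/-- The value `Ψ y = sup {x |y| - Φ x : x ≥ 0}` of the complementary function. -/
def conjFun (Φ : NFunction) (y : ℝ) : ℝ := sSup (Φ.conjSet y)

theorem le_conjFun (Φ : NFunction) {x : ℝ} (hx : 0 ≤ x) (y : ℝ) :
    x * |y| - Φ x ≤ Φ.conjFun y :=
  le_csSup (Φ.conjSet_bddAbove y) ⟨x, hx, rfl⟩

theorem conjFun_le (Φ : NFunction) {y b : ℝ} (h : ∀ x, 0 ≤ x → x * |y| - Φ x ≤ b) :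
    Φ.conjFun y ≤ b :=
  csSup_le ⟨_, 0, le_rfl, rfl⟩ (by rintro _ ⟨x, hx, rfl⟩; exact h x hx)

theorem conjFun_nonneg (Φ : NFunction) (y : ℝ) : 0 ≤ Φ.conjFun y := by
  simpa [Φ.map_zero] using Φ.le_conjFun le_rfl y

theorem conjFun_abs_le (Φ : NFunction) {ε : ℝ} (hε : 0 < ε) {y : ℝ} (hy : |y| ≤ Φ ε / ε) :
    Φ.conjFun y ≤ ε * |y| := by
  refine Φ.conjFun_le fun x hx => ?_
  rcases le_total x ε with h | h
  · have := Φ.nonneg' x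
    have := mul_le_mul_of_nonneg_right h (abs_nonneg y)
    linarith
  · have hx0 : 0 < x := hε.trans_le h
    have h1 := Φ.le_scale (div_nonneg hε.le hx) ((div_le_one hx0).2 h) x
    rw [div_mul_cancel₀ _ hx0.ne', div_mul_eq_mul_div, le_div_iff₀ hx0] at h1
    rw [le_div_iff₀ hε] at hy
    have h2 : ε * (x * |y|) ≤ ε * Φ x := by nlinarith
    have h3 := le_of_mul_le_mul_left h2 hε
    have : 0 ≤ ε * |y| := by positivity
    linarith

/-- The `N`-function `Ψ` complementary to `Φ`: `Ψ y = sup {x |y| - Φ x : x ≥ 0}`. -/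
def complementary (Φ : NFunction) : NFunction where
  toFun := Φ.conjFun
  nonneg' := Φ.conjFun_nonneg
  even' y := by simp [conjFun, conjSet]
  convex' := by
    refine ⟨convex_univ, fun y _ z _ a b ha hb hab => ?_⟩
    refine Φ.conjFun_le fun x hx => ?_
    have h1 := mul_le_mul_of_nonneg_left (Φ.le_conjFun hx y) ha
    have h2 := mul_le_mul_of_nonneg_left (Φ.le_conjFun hx z) hb
    have h3 : |a • y + b • z| ≤ a * |y| + b * |z| := by
      refine (abs_add_le _ _).trans ?_
      simp [abs_mul, abs_of_nonneg ha, abs_of_nonneg hb]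
    have h4 := mul_le_mul_of_nonneg_left h3 hx
    have h5 : Φ x = a * Φ x + b * Φ x := by rw [← add_mul, hab, one_mul]
    simp only [smul_eq_mul] at *
    nlinarith
  eq_zero_iff' y := by
    constructor
    · intro h
      by_contra hy
      have h1 : ∀ᶠ x in 𝓝[>] (0 : ℝ), Φ x / x < |y| :=
        (Φ.tendsto_zero'.mono_left (nhdsWithin_mono _ fun x hx => ne_of_gt hx)).eventually_lt_const
          (abs_pos.2 hy)
      obtain ⟨x, hx, hx0⟩ := (h1.and self_mem_nhdsWithin).exists
      have hx0 : 0 < x := hx0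
      rw [div_lt_iff₀ hx0] at hx
      have := Φ.le_conjFun hx0.le y
      linarith [mul_comm x |y|]
    · rintro rfl
      refine le_antisymm (Φ.conjFun_le fun x _ => ?_) (Φ.conjFun_nonneg 0)
      simpa using Φ.nonneg' x
  tendsto_zero' := by
    rw [Metric.tendsto_nhds]
    intro ε hε
    have hc : 0 < Φ (ε / 2) := lt_of_le_of_ne (Φ.nonneg' _)
      fun h => (half_pos hε).ne' ((Φ.eq_zero_iff' _).1 h.symm)
    have h : ∀ᶠ y in 𝓝 (0 : ℝ), |y| < Φ (ε / 2) / (ε / 2) :=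
      (continuous_abs.tendsto' (0 : ℝ) 0 abs_zero).eventually_lt_const (by positivity)
    filter_upwards [nhdsWithin_le_nhds h, self_mem_nhdsWithin] with y hy hy0
    have hy1 : 0 < |y| := abs_pos.2 hy0
    have := Φ.conjFun_abs_le (half_pos hε) hy.le
    rw [Real.dist_eq, sub_zero, abs_div, abs_of_nonneg (Φ.conjFun_nonneg y), div_lt_iff₀ hy1]
    nlinarith
  tendsto_atTop' := by
    rw [tendsto_atTop]
    intro b
    filter_upwards [eventually_ge_atTop (Φ (|b| + 1)), eventually_gt_atTop 0] with y hy hy0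
    have := Φ.le_conjFun (x := |b| + 1) (by positivity) y
    rw [abs_of_pos hy0] at this
    rw [le_div_iff₀ hy0]
    nlinarith [le_abs_self b]

/-- Condition (A): `∫₀¹ Φ(v) / v² dv < ∞`. -/
def ConditionA (Φ : NFunction) : Prop :=
  ∫⁻ v in Ioc (0 : ℝ) 1, ENNReal.ofReal (Φ v / v ^ 2) < ∞

end NFunction

/-! ## Orlicz spaces of sections of a trivial vector bundle with a continuous fibre metric -/

/-- A continuous family of norms on the fibres `V` of the trivial bundle `X × V`. -/
structure FibreNorm (X V : Type*) [TopologicalSpace X] [TopologicalSpace V] [AddCommGroup V]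
    [Module ℝ V] where
  norm : X → Seminorm ℝ V
  eq_zero' : ∀ x v, norm x v = 0 → v = 0
  continuous' : Continuous fun q : X × V => norm q.1 q.2

section Orlicz

variable {X V : Type*} [TopologicalSpace X] [TopologicalSpace.PseudoMetrizableSpace X]
  [SecondCountableTopology X] [MeasurableSpace X] [OpensMeasurableSpace X] [NormedAddCommGroup V] [NormedSpace ℝ V]

/-- The modular `ρ_Φ(ω) = ∫ Φ(|ω(x)|) dμ(x)`. -/
def modular (Φ : NFunction) (N : FibreNorm X V) (μ : Measure X) (ω : X →ₘ[μ] V) : ℝ≥0∞ :=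
  ∫⁻ x, ENNReal.ofReal (Φ (N.norm x (ω x))) ∂μ

theorem modular_aemeasurable (Φ : NFunction) (N : FibreNorm X V) (μ : Measure X)
    (ω : X →ₘ[μ] V) (c : ℝ) :
    AEMeasurable (fun x => ENNReal.ofReal (Φ (c * N.norm x (ω x)))) μ := by
  have h : AEStronglyMeasurable (fun x => N.norm x (ω x)) μ :=
    N.continuous'.comp_aestronglyMeasurable
      (aestronglyMeasurable_id.prodMk ω.aestronglyMeasurable)
  exact ((Φ.continuous.comp (continuous_const.mul
    continuous_id)).comp_aestronglyMeasurable h).aemeasurable.ennreal_ofReal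

theorem modular_smul (Φ : NFunction) (N : FibreNorm X V) (μ : Measure X) (ω : X →ₘ[μ] V) (c : ℝ) :
    modular Φ N μ (c • ω) = ∫⁻ x, ENNReal.ofReal (Φ (|c| * N.norm x (ω x))) ∂μ := by
  refine lintegral_congr_ae ?_
  filter_upwards [AEEqFun.coeFn_smul c ω] with x hx
  rw [hx, Pi.smul_apply, map_smul_eq_mul, Real.norm_eq_abs]

theorem modular_zero (Φ : NFunction) (N : FibreNorm X V) (μ : Measure X) :
    modular Φ N μ 0 = 0 := by
  have := modular_smul Φ N μ 0 0
  simpa [Φ.map_zero] using this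

theorem modular_smul_le (Φ : NFunction) (N : FibreNorm X V) (μ : Measure X) (ω : X →ₘ[μ] V)
    {t : ℝ} (h0 : 0 ≤ t) (h1 : t ≤ 1) :
    modular Φ N μ (t • ω) ≤ ENNReal.ofReal t * modular Φ N μ ω := by
  rw [modular_smul, modular, ← lintegral_const_mul' _ _ ENNReal.ofReal_ne_top]
  refine lintegral_mono fun x => ?_
  simp only
  rw [abs_of_nonneg h0, ← ENNReal.ofReal_mul h0]
  exact ENNReal.ofReal_le_ofReal (Φ.le_scale h0 h1 _)

theorem modular_convex (Φ : NFunction) (N : FibreNorm X V) (μ : Measure X) (ω η : X →ₘ[μ] V)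
    {s t : ℝ} (hs : 0 ≤ s) (ht : 0 ≤ t) (hst : s + t = 1) :
    modular Φ N μ (s • ω + t • η) ≤
      ENNReal.ofReal s * modular Φ N μ ω + ENNReal.ofReal t * modular Φ N μ η := by
  have hm := (modular_aemeasurable Φ N μ ω 1).const_mul (ENNReal.ofReal s)
  simp only [one_mul] at hm
  rw [modular, modular, modular, ← lintegral_const_mul' _ _ ENNReal.ofReal_ne_top,
    ← lintegral_const_mul' _ _ ENNReal.ofReal_ne_top, ← lintegral_add_left' hm]
  refine lintegral_mono_ae ?_
  filter_upwards [AEEqFun.coeFn_add (s • ω) (t • η), AEEqFun.coeFn_smul s ω,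
    AEEqFun.coeFn_smul t η] with x h1 h2 h3
  rw [h1, Pi.add_apply, h2, h3, Pi.smul_apply, Pi.smul_apply, ← ENNReal.ofReal_mul hs,
    ← ENNReal.ofReal_mul ht, ← ENNReal.ofReal_add (mul_nonneg hs (Φ.nonneg' _))
      (mul_nonneg ht (Φ.nonneg' _))]
  refine ENNReal.ofReal_le_ofReal ?_
  refine (Φ.mono (apply_nonneg _ _) (map_add_le_add (N.norm x) _ _)).trans ?_
  rw [map_smul_eq_mul, map_smul_eq_mul, Real.norm_of_nonneg hs, Real.norm_of_nonneg ht]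
  exact Φ.convex'.2 (mem_univ _) (mem_univ _) hs ht hst

/-- The scalars `K > 0` with `ρ_Φ(ω / K) ≤ 1`. -/
def gaugeSet (Φ : NFunction) (N : FibreNorm X V) (μ : Measure X) (ω : X →ₘ[μ] V) : Set ℝ :=
  {K | 0 < K ∧ modular Φ N μ (K⁻¹ • ω) ≤ 1}

/-- The gauge (Luxemburg) norm `‖ω‖_(Φ) = inf {K > 0 : ρ_Φ(ω / K) ≤ 1}`. -/
def gaugeNorm (Φ : NFunction) (N : FibreNorm X V) (μ : Measure X) (ω : X →ₘ[μ] V) : ℝ :=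
  sInf (gaugeSet Φ N μ ω)

theorem gaugeSet_bddBelow (Φ : NFunction) (N : FibreNorm X V) (μ : Measure X) (ω : X →ₘ[μ] V) :
    BddBelow (gaugeSet Φ N μ ω) := ⟨0, fun _ h => h.1.le⟩

theorem gaugeSet_nonempty_iff (Φ : NFunction) (N : FibreNorm X V) (μ : Measure X)
    (ω : X →ₘ[μ] V) :
    (gaugeSet Φ N μ ω).Nonempty ↔ ∃ a : ℝ, 0 < a ∧ modular Φ N μ (a • ω) < ∞ := by
  constructor
  · rintro ⟨K, hK, h⟩
    exact ⟨K⁻¹, inv_pos.2 hK, h.trans_lt ENNReal.one_lt_top⟩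
  · rintro ⟨a, ha, h⟩
    set M := (modular Φ N μ (a • ω)).toReal
    have hM : 0 ≤ M := ENNReal.toReal_nonneg
    have hM1 : 0 < M + 1 := by linarith
    have hK : 0 < (M + 1) / a := div_pos hM1 ha
    refine ⟨(M + 1) / a, hK, ?_⟩
    have h1 := modular_smul_le Φ N μ (a • ω) (inv_nonneg.2 hM1.le)
      (inv_le_one_of_one_le₀ (by linarith : (1 : ℝ) ≤ M + 1))
    rw [smul_smul, ← ENNReal.ofReal_toReal h.ne, ← ENNReal.ofReal_mul (inv_nonneg.2 hM1.le)] at h1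
    rw [inv_div, div_eq_inv_mul]
    refine h1.trans (ENNReal.ofReal_le_one.2 ?_)
    rw [inv_mul_le_iff₀ hM1]
    simp only [mul_one]
    linarith

theorem gaugeSet_add (Φ : NFunction) (N : FibreNorm X V) (μ : Measure X) {ω η : X →ₘ[μ] V}
    {K L : ℝ} (hK : K ∈ gaugeSet Φ N μ ω) (hL : L ∈ gaugeSet Φ N μ η) :
    K + L ∈ gaugeSet Φ N μ (ω + η) := by
  have hK0 := hK.1
  have hL0 := hL.1
  refine ⟨by linarith, ?_⟩
  have h := modular_convex Φ N μ (K⁻¹ • ω) (L⁻¹ • η) (s := K / (K + L)) (t := L / (K + L))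
    (by positivity) (by positivity) (by field_simp)
  rw [smul_smul, smul_smul] at h
  have e1 : K / (K + L) * K⁻¹ = (K + L)⁻¹ := by field_simp
  have e2 : L / (K + L) * L⁻¹ = (K + L)⁻¹ := by field_simp
  rw [e1, e2, ← smul_add] at h
  refine h.trans ((add_le_add (mul_le_mul_right hK.2 _) (mul_le_mul_right hL.2 _)).trans ?_)
  rw [mul_one, mul_one, ← ENNReal.ofReal_add (by positivity) (by positivity)]
  refine ENNReal.ofReal_le_one.2 (le_of_eq ?_)
  field_simp

theorem gaugeSet_smul (Φ : NFunction) (N : FibreNorm X V) (μ : Measure X) {ω : X →ₘ[μ] V}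
    {K : ℝ} (hK : K ∈ gaugeSet Φ N μ ω) {c : ℝ} (hc : c ≠ 0) :
    |c| * K ∈ gaugeSet Φ N μ (c • ω) := by
  have hK0 := hK.1
  have hc0 : 0 < |c| := abs_pos.2 hc
  refine ⟨by positivity, ?_⟩
  have h := hK.2
  rw [modular_smul] at h
  rw [smul_smul, modular_smul]
  have e : |(|c| * K)⁻¹ * c| = |K⁻¹| := by
    rw [abs_mul, abs_inv, abs_mul, abs_abs, abs_inv]
    field_simp
  rwa [e]

/-- The Orlicz space `L^Φ` of (classes modulo null sets of) measurable sections `ω` with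
`ρ_Φ(a ω) < ∞` for some `a > 0`. -/
def orliczSpace (Φ : NFunction) (N : FibreNorm X V) (μ : Measure X) :
    Submodule ℝ (X →ₘ[μ] V) where
  carrier := {ω | ∃ a : ℝ, 0 < a ∧ modular Φ N μ (a • ω) < ∞}
  zero_mem' := ⟨1, one_pos, by rw [smul_zero, modular_zero]; exact ENNReal.zero_lt_top⟩
  add_mem' := by
    intro ω η hω hη
    simp only [mem_ofPred_eq, ← gaugeSet_nonempty_iff] at *
    obtain ⟨K, hK⟩ := hω
    obtain ⟨L, hL⟩ := hη
    exact ⟨_, gaugeSet_add Φ N μ hK hL⟩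
  smul_mem' := by
    intro c ω hω
    rcases eq_or_ne c 0 with rfl | hc
    · rw [zero_smul]
      exact ⟨1, one_pos, by rw [smul_zero, modular_zero]; exact ENNReal.zero_lt_top⟩
    · simp only [mem_ofPred_eq, ← gaugeSet_nonempty_iff] at *
      obtain ⟨K, hK⟩ := hω
      exact ⟨_, gaugeSet_smul Φ N μ hK hc⟩

theorem orliczSpace_gaugeSet_nonempty {Φ : NFunction} {N : FibreNorm X V} {μ : Measure X}
    (ω : orliczSpace Φ N μ) : (gaugeSet Φ N μ (ω : X →ₘ[μ] V)).Nonempty :=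
  (gaugeSet_nonempty_iff Φ N μ _).2 ω.2

theorem gaugeNorm_smul_le (Φ : NFunction) (N : FibreNorm X V) (μ : Measure X) (ω : X →ₘ[μ] V)
    (hω : (gaugeSet Φ N μ ω).Nonempty) {c : ℝ} (hc : c ≠ 0) :
    gaugeNorm Φ N μ (c • ω) ≤ |c| * gaugeNorm Φ N μ ω := by
  have hc0 : 0 < |c| := abs_pos.2 hc
  rw [← div_le_iff₀' hc0]
  refine le_csInf hω fun K hK => ?_
  rw [div_le_iff₀' hc0]
  exact csInf_le (gaugeSet_bddBelow Φ N μ _) (gaugeSet_smul Φ N μ hK hc)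

theorem gaugeNorm_zero (Φ : NFunction) (N : FibreNorm X V) (μ : Measure X) :
    gaugeNorm Φ N μ 0 = 0 := by
  have : gaugeSet Φ N μ 0 = Ioi 0 := by
    ext K
    simp [gaugeSet, modular_zero]
  rw [gaugeNorm, this, csInf_Ioi]

theorem eq_zero_of_gaugeNorm_eq_zero (Φ : NFunction) (N : FibreNorm X V) (μ : Measure X)
    (ω : X →ₘ[μ] V) (hω : (gaugeSet Φ N μ ω).Nonempty) (h : gaugeNorm Φ N μ ω = 0) : ω = 0 := by
  have key : ∀ t : ℝ, 0 < t → t ≤ 1 → modular Φ N μ ω ≤ ENNReal.ofReal t := by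
    intro t ht ht1
    obtain ⟨K, hK, hKt⟩ := exists_lt_of_csInf_lt hω (h.trans_lt ht)
    have hK0 := hK.1
    have h1 := modular_smul_le Φ N μ (K⁻¹ • ω) hK0.le (hKt.le.trans ht1)
    rw [smul_smul, mul_inv_cancel₀ hK0.ne', one_smul] at h1
    exact (h1.trans (mul_le_of_le_one_right' hK.2)).trans (ENNReal.ofReal_le_ofReal hKt.le)
  have h0 : modular Φ N μ ω = 0 := by
    refine le_antisymm (ENNReal.le_of_forall_pos_le_add fun ε hε _ => ?_) bot_le
    rw [zero_add]
    have hε' : (0 : ℝ) < ε := hε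
    refine (key (min ε 1) (lt_min hε' one_pos) (min_le_right _ _)).trans ?_
    exact (ENNReal.ofReal_le_ofReal (min_le_left _ _)).trans (by simp)
  have hm := modular_aemeasurable Φ N μ ω 1
  simp only [one_mul] at hm
  rw [modular, lintegral_eq_zero_iff' hm] at h0
  refine AEEqFun.ext ?_
  filter_upwards [h0, AEEqFun.coeFn_zero (α := X) (β := V) (μ := μ)] with x hx hz
  rw [hz, Pi.zero_apply]
  refine N.eq_zero' x _ ((Φ.eq_zero_iff' _).1 (le_antisymm ?_ (Φ.nonneg' _)))
  exact ENNReal.ofReal_eq_zero.1 hx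

instance (Φ : NFunction) (N : FibreNorm X V) (μ : Measure X) : Norm (orliczSpace Φ N μ) :=
  ⟨fun ω => gaugeNorm Φ N μ (ω : X →ₘ[μ] V)⟩

theorem orliczSpace_normCore (Φ : NFunction) (N : FibreNorm X V) (μ : Measure X) :
    NormedSpace.Core ℝ (orliczSpace Φ N μ) where
  norm_nonneg ω := Real.sInf_nonneg fun _ h => h.1.le
  norm_smul c ω := by
    change gaugeNorm Φ N μ (c • (ω : X →ₘ[μ] V)) = ‖c‖ * gaugeNorm Φ N μ (ω : X →ₘ[μ] V)
    rcases eq_or_ne c 0 with rfl | hc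
    · simp [gaugeNorm_zero]
    · refine le_antisymm
        (gaugeNorm_smul_le Φ N μ _ (orliczSpace_gaugeSet_nonempty ω) hc) ?_
      have h := gaugeNorm_smul_le Φ N μ (c • (ω : X →ₘ[μ] V))
        (orliczSpace_gaugeSet_nonempty (c • ω)) (inv_ne_zero hc)
      rw [smul_smul, inv_mul_cancel₀ hc, one_smul, abs_inv, ← div_eq_inv_mul,
        le_div_iff₀' (abs_pos.2 hc)] at h
      exact h
  norm_triangle ω η := by
    change gaugeNorm Φ N μ ((ω : X →ₘ[μ] V) + η) ≤ gaugeNorm Φ N μ (ω : X →ₘ[μ] V) +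
      gaugeNorm Φ N μ (η : X →ₘ[μ] V)
    rw [← sub_le_iff_le_add]
    refine le_csInf (orliczSpace_gaugeSet_nonempty ω) fun K hK => ?_
    rw [sub_le_iff_le_add, ← sub_le_iff_le_add']
    refine le_csInf (orliczSpace_gaugeSet_nonempty η) fun L hL => ?_
    rw [sub_le_iff_le_add']
    exact csInf_le (gaugeSet_bddBelow Φ N μ _) (gaugeSet_add Φ N μ hK hL)
  norm_eq_zero_iff ω := by
    constructor
    · intro h
      exact Subtype.ext (eq_zero_of_gaugeNorm_eq_zero Φ N μ _
        (orliczSpace_gaugeSet_nonempty ω) h)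
    · rintro rfl
      exact gaugeNorm_zero Φ N μ

instance (Φ : NFunction) (N : FibreNorm X V) (μ : Measure X) :
    NormedAddCommGroup (orliczSpace Φ N μ) :=
  NormedAddCommGroup.ofCore (orliczSpace_normCore Φ N μ)

instance (Φ : NFunction) (N : FibreNorm X V) (μ : Measure X) :
    NormedSpace ℝ (orliczSpace Φ N μ) :=
  NormedSpace.ofCore (orliczSpace_normCore Φ N μ)

end Orlicz

/-! ## The hyperbolic plane -/

/-- The hyperbolic plane, modelled as `ℝ²` with coordinates `p = (y, z)` and the Riemannian metric
`ds² = e^{2z} dy² + dz²`. -/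
abbrev HypPlane := ℝ × ℝ

namespace HypPlane

/-- The coordinate vector field `∂/∂y`. -/
def ey : HypPlane := (1, 0)

/-- The coordinate vector field `∂/∂z`. -/
def ez : HypPlane := (0, 1)

/-- The Riemannian metric `e^{2z} dy² + dz²` at `p = (y, z)`. -/
def metric (p v w : HypPlane) : ℝ := Real.exp (2 * p.2) * (v.1 * w.1) + v.2 * w.2

/-- The Riemannian area `dA = √(det g) dy dz = e^z dy dz`. -/
def area : Measure HypPlane :=
  (volume : Measure HypPlane).withDensity fun p => ENNReal.ofReal (Real.exp p.2)

/-- Covectors (values of differential `1`-forms). -/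
abbrev Covector := HypPlane →L[ℝ] ℝ

/-- The length `|ξ|` of a covector at `p = (y, z)`:
`|a dy + b dz|² = e^{-2z} a² + b²`. -/
def covectorLength (p : HypPlane) (ξ : Covector) : ℝ :=
  Real.sqrt ((Real.exp (-p.2) * ξ ey) ^ 2 + ξ ez ^ 2)

theorem covector_apply (ξ : Covector) (v : HypPlane) : ξ v = v.1 * ξ ey + v.2 * ξ ez := by
  have : v = v.1 • ey + v.2 • ez := by ext <;> simp [ey, ez]
  conv_lhs => rw [this, map_add, map_smul, map_smul, smul_eq_mul, smul_eq_mul]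

/-- `|ξ|` is the norm dual to the Riemannian metric. -/
theorem covectorLength_isGreatest (p : HypPlane) (ξ : Covector) :
    IsGreatest {s | ∃ v : HypPlane, metric p v v ≤ 1 ∧ s = ξ v} (covectorLength p ξ) := by
  have hE : Real.exp p.2 * Real.exp (-p.2) = 1 := by rw [← Real.exp_add]; simp
  have h2 : Real.exp (2 * p.2) = Real.exp p.2 ^ 2 := by rw [two_mul, Real.exp_add, sq]
  set E := Real.exp p.2
  set F := Real.exp (-p.2)
  have hD : 0 ≤ (F * ξ ey) ^ 2 + ξ ez ^ 2 := by positivity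
  have hsq := Real.sq_sqrt hD
  constructor
  · rcases (Real.sqrt_nonneg ((F * ξ ey) ^ 2 + ξ ez ^ 2)).eq_or_lt with h | h
    · exact ⟨0, by simp [metric], by simpa [covectorLength] using h.symm⟩
    · set L := Real.sqrt ((F * ξ ey) ^ 2 + ξ ez ^ 2)
      refine ⟨(F ^ 2 * ξ ey / L, ξ ez / L), ?_, ?_⟩
      · simp only [metric, h2]
        have : E ^ 2 * (F ^ 2 * ξ ey / L * (F ^ 2 * ξ ey / L)) + ξ ez / L * (ξ ez / L) =
            ((E * F) ^ 2 * (F * ξ ey) ^ 2 + ξ ez ^ 2) / L ^ 2 := by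
          field_simp
        rw [this, hE, one_pow, one_mul, ← hsq, div_self (by positivity)]
      · rw [covector_apply]
        change L = _
        have : F ^ 2 * ξ ey / L * ξ ey + ξ ez / L * ξ ez =
            ((F * ξ ey) ^ 2 + ξ ez ^ 2) / L := by
          field_simp
        rw [this, ← hsq]
        field_simp
  · rintro _ ⟨v, hv, rfl⟩
    rw [covector_apply]
    refine Real.le_sqrt_of_sq_le ?_
    simp only [metric, h2] at hv
    have e : v.1 * ξ ey + v.2 * ξ ez = (E * v.1) * (F * ξ ey) + v.2 * ξ ez := by
      linear_combination (-(v.1 * ξ ey)) * hE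
    rw [e]
    have c : ((E * v.1) * (F * ξ ey) + v.2 * ξ ez) ^ 2 ≤
        ((E * v.1) ^ 2 + v.2 ^ 2) * ((F * ξ ey) ^ 2 + ξ ez ^ 2) := by
      nlinarith [sq_nonneg ((E * v.1) * ξ ez - v.2 * (F * ξ ey))]
    refine c.trans (mul_le_of_le_one_left hD ?_)
    linarith [mul_pow E v.1 2]

/-- The pointwise length `|ω(p)|` of differential `1`-forms on the hyperbolic plane. -/
def oneFormNorm : FibreNorm HypPlane Covector where
  norm p := Seminorm.of (covectorLength p)
    (by
      intro ξ η
      obtain ⟨v, hv, h⟩ := (covectorLength_isGreatest p (ξ + η)).1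
      rw [h]
      exact add_le_add ((covectorLength_isGreatest p ξ).2 ⟨v, hv, rfl⟩)
        ((covectorLength_isGreatest p η).2 ⟨v, hv, rfl⟩))
    (by
      intro c ξ
      simp only [covectorLength, smul_apply, smul_eq_mul]
      rw [show (Real.exp (-p.2) * (c * ξ ey)) ^ 2 + (c * ξ ez) ^ 2 =
        c ^ 2 * ((Real.exp (-p.2) * ξ ey) ^ 2 + ξ ez ^ 2) by ring,
        Real.sqrt_mul (sq_nonneg c), Real.sqrt_sq_eq_abs, Real.norm_eq_abs])
  eq_zero' p ξ h := by
    have h' : covectorLength p ξ = 0 := h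
    rw [covectorLength, Real.sqrt_eq_zero (by positivity)] at h'
    have h1 : (Real.exp (-p.2) * ξ ey) ^ 2 = 0 := by
      nlinarith [sq_nonneg (ξ ez), sq_nonneg (Real.exp (-p.2) * ξ ey)]
    have h2 : ξ ez ^ 2 = 0 := by nlinarith [sq_nonneg (ξ ez)]
    have h3 : ξ ey = 0 := by
      have := (pow_eq_zero_iff two_ne_zero).1 h1
      exact (mul_eq_zero.1 this).resolve_left (Real.exp_pos _).ne'
    have h4 : ξ ez = 0 := (pow_eq_zero_iff two_ne_zero).1 h2
    refine ContinuousLinearMap.ext fun v => ?_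
    rw [covector_apply, h3, h4]
    simp
  continuous' := by
    change Continuous fun q : HypPlane × Covector => covectorLength q.1 q.2
    unfold covectorLength
    fun_prop

/-- The pointwise length `|β(p)|` of functions (differential `0`-forms). -/
def zeroFormNorm : FibreNorm HypPlane ℝ where
  norm _ := normSeminorm ℝ ℝ
  eq_zero' _ _ h := norm_eq_zero.1 h
  continuous' := by
    change Continuous fun q : HypPlane × ℝ => ‖q.2‖
    fun_prop

/-- The value `(ξ ∧ η)(∂/∂y, ∂/∂z)`, that is, the coefficient of `ξ ∧ η` with respect to
`dy ∧ dz`. -/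
def wedge (ξ η : Covector) : ℝ := ξ ey * η ez - ξ ez * η ey

/-- The coefficient `du(∂/∂y, ∂/∂z)` of the exterior derivative of a `1`-form `u` with respect to
`dy ∧ dz`. -/
def dOneForm (u : HypPlane → Covector) (p : HypPlane) : ℝ :=
  fderiv ℝ u p ey ez - fderiv ℝ u p ez ey

/-- `θ` is the weak differential `dβ` of the function `β`: both are locally integrable and
`∫ β du = - ∫ θ ∧ u` for all smooth compactly supported `1`-forms `u`.  (Integrals of `2`-forms are
Lebesgue integrals of their coefficients with respect to `dy ∧ dz`.) -/
def IsWeakDifferentialZero (β : HypPlane → ℝ) (θ : HypPlane → Covector) : Prop :=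
  LocallyIntegrable β ∧ LocallyIntegrable θ ∧
    ∀ u : HypPlane → Covector, ContDiff ℝ (⊤ : ℕ∞) u → HasCompactSupport u →
      ∫ p, β p * dOneForm u p = -∫ p, wedge (θ p) (u p)

/-- `θ dy ∧ dz` is the weak differential `dω` of the `1`-form `ω`: both are locally integrable and
`∫ ω ∧ du = ∫ u θ` for all smooth compactly supported functions `u`. -/
def IsWeakDifferentialOne (ω : HypPlane → Covector) (θ : HypPlane → ℝ) : Prop :=
  LocallyIntegrable ω ∧ LocallyIntegrable θ ∧
    ∀ u : HypPlane → ℝ, ContDiff ℝ (⊤ : ℕ∞) u → HasCompactSupport u →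
      ∫ p, wedge (ω p) (fderiv ℝ u p) = ∫ p, θ p * u p

theorem volume_absolutelyContinuous_area : (volume : Measure HypPlane) ≪ area := by
  refine withDensity_absolutelyContinuous' (by fun_prop) (Eventually.of_forall fun p => ?_)
  simp [Real.exp_pos]

theorem locallyIntegrable_apply {ω : HypPlane → Covector} (h : LocallyIntegrable ω)
    (v : HypPlane) : LocallyIntegrable fun p => ω p v := by
  rw [← locallyIntegrableOn_univ] at *
  exact (ContinuousLinearMap.apply ℝ ℝ v).locallyIntegrableOn_comp h

theorem locallyIntegrable_add {E : Type*} [NormedAddCommGroup E] {f g : HypPlane → E}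
    (hf : LocallyIntegrable f) (hg : LocallyIntegrable g) : LocallyIntegrable (f + g) :=
  hf.add hg

theorem integrable_mul_test {f g : HypPlane → ℝ} (hf : LocallyIntegrable f) (hg : Continuous g)
    (hc : HasCompactSupport g) : Integrable fun p => f p * g p := by
  simpa [mul_comm] using hf.integrable_smul_left_of_hasCompactSupport hg hc

theorem hasCompactSupport_clm_apply {E F : Type*} [NormedAddCommGroup E] [NormedSpace ℝ E]
    [NormedAddCommGroup F] [NormedSpace ℝ F] {u : HypPlane → E →L[ℝ] F}
    (h : HasCompactSupport u) (v : E) : HasCompactSupport fun p => u p v :=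
  h.comp_left (g := fun A : E →L[ℝ] F => A v) (by simp)

theorem integrable_wedge {ω u : HypPlane → Covector} (hω : LocallyIntegrable ω)
    (hu : Continuous u) (hc : HasCompactSupport u) : Integrable fun p => wedge (ω p) (u p) :=
  (integrable_mul_test (locallyIntegrable_apply hω ey) (by fun_prop)
    (hasCompactSupport_clm_apply hc ez)).sub
  (integrable_mul_test (locallyIntegrable_apply hω ez) (by fun_prop)
    (hasCompactSupport_clm_apply hc ey))

theorem integrable_mul_dOneForm {β : HypPlane → ℝ} {u : HypPlane → Covector}
    (hβ : LocallyIntegrable β) (hu : ContDiff ℝ (⊤ : ℕ∞) u) (hc : HasCompactSupport u) :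
    Integrable fun p => β p * dOneForm u p := by
  have hd : Continuous (fderiv ℝ u) := hu.continuous_fderiv (by simp)
  have h1 : ∀ v w : HypPlane, Integrable fun p => β p * fderiv ℝ u p v w := fun v w =>
    integrable_mul_test hβ (by fun_prop)
      (hasCompactSupport_clm_apply (hasCompactSupport_clm_apply (hc.fderiv ℝ) v) w)
  simp only [dOneForm, mul_sub]
  exact (h1 ey ez).sub (h1 ez ey)

theorem wedge_add_left (ξ η ζ : Covector) : wedge (ξ + η) ζ = wedge ξ ζ + wedge η ζ := by
  simp only [wedge, add_apply]; ring

theorem wedge_smul_left (c : ℝ) (ξ ζ : Covector) : wedge (c • ξ) ζ = c * wedge ξ ζ := by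
  simp only [wedge, smul_apply, smul_eq_mul]; ring

theorem IsWeakDifferentialZero.congr {β β' : HypPlane → ℝ} {θ θ' : HypPlane → Covector}
    (h : IsWeakDifferentialZero β θ) (hβ : β =ᵐ[area] β') (hθ : θ =ᵐ[area] θ') :
    IsWeakDifferentialZero β' θ' := by
  have hβ := volume_absolutelyContinuous_area.ae_le hβ
  have hθ := volume_absolutelyContinuous_area.ae_le hθ
  refine ⟨h.1.congr hβ, h.2.1.congr hθ, fun u hu hc => ?_⟩
  have e1 : ∫ p, β p * dOneForm u p = ∫ p, β' p * dOneForm u p :=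
    integral_congr_ae (by filter_upwards [hβ] with p hp; rw [hp])
  have e2 : ∫ p, wedge (θ p) (u p) = ∫ p, wedge (θ' p) (u p) :=
    integral_congr_ae (by filter_upwards [hθ] with p hp; rw [hp])
  rw [← e1, ← e2]
  exact h.2.2 u hu hc

theorem IsWeakDifferentialZero.zero : IsWeakDifferentialZero 0 0 :=
  ⟨locallyIntegrable_const 0, locallyIntegrable_const 0, fun u _ _ => by simp [wedge]⟩

theorem IsWeakDifferentialZero.add {β β' : HypPlane → ℝ} {θ θ' : HypPlane → Covector}
    (h : IsWeakDifferentialZero β θ) (h' : IsWeakDifferentialZero β' θ') :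
    IsWeakDifferentialZero (β + β') (θ + θ') := by
  refine ⟨locallyIntegrable_add h.1 h'.1, locallyIntegrable_add h.2.1 h'.2.1, fun u hu hc => ?_⟩
  simp only [Pi.add_apply, add_mul, wedge_add_left]
  rw [integral_add (integrable_mul_dOneForm h.1 hu hc) (integrable_mul_dOneForm h'.1 hu hc),
    integral_add (integrable_wedge h.2.1 hu.continuous hc)
      (integrable_wedge h'.2.1 hu.continuous hc), h.2.2 u hu hc, h'.2.2 u hu hc]
  ring

theorem IsWeakDifferentialZero.smul {β : HypPlane → ℝ} {θ : HypPlane → Covector}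
    (h : IsWeakDifferentialZero β θ) (c : ℝ) : IsWeakDifferentialZero (c • β) (c • θ) := by
  refine ⟨h.1.smul c, h.2.1.smul c, fun u hu hc => ?_⟩
  simp only [Pi.smul_apply, smul_eq_mul, mul_assoc, wedge_smul_left, integral_const_mul]
  rw [h.2.2 u hu hc]
  ring

theorem IsWeakDifferentialOne.congr {ω ω' : HypPlane → Covector} {θ : HypPlane → ℝ}
    (h : IsWeakDifferentialOne ω θ) (hω : ω =ᵐ[area] ω') : IsWeakDifferentialOne ω' θ := by
  have hω := volume_absolutelyContinuous_area.ae_le hω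
  refine ⟨h.1.congr hω, h.2.1, fun u hu hc => ?_⟩
  rw [← h.2.2 u hu hc]
  exact integral_congr_ae (by filter_upwards [hω] with p hp; rw [hp])

theorem IsWeakDifferentialOne.add {ω ω' : HypPlane → Covector} {θ θ' : HypPlane → ℝ}
    (h : IsWeakDifferentialOne ω θ) (h' : IsWeakDifferentialOne ω' θ') :
    IsWeakDifferentialOne (ω + ω') (θ + θ') := by
  refine ⟨locallyIntegrable_add h.1 h'.1, locallyIntegrable_add h.2.1 h'.2.1, fun u hu hc => ?_⟩
  have hd : Continuous (fderiv ℝ u) := hu.continuous_fderiv (by simp)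
  simp only [Pi.add_apply, add_mul, wedge_add_left]
  rw [integral_add (integrable_wedge h.1 hd (hc.fderiv ℝ))
    (integrable_wedge h'.1 hd (hc.fderiv ℝ)),
    integral_add (integrable_mul_test h.2.1 hu.continuous hc)
      (integrable_mul_test h'.2.1 hu.continuous hc), h.2.2 u hu hc, h'.2.2 u hu hc]

theorem IsWeakDifferentialOne.smul {ω : HypPlane → Covector} {θ : HypPlane → ℝ}
    (h : IsWeakDifferentialOne ω θ) (c : ℝ) : IsWeakDifferentialOne (c • ω) (c • θ) := by
  refine ⟨h.1.smul c, h.2.1.smul c, fun u hu hc => ?_⟩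
  simp only [Pi.smul_apply, smul_eq_mul, mul_assoc, wedge_smul_left, integral_const_mul]
  rw [h.2.2 u hu hc]

/-! ## Orlicz cohomology in degree one -/

/-- `L^Φ(ℍ², Λ⁰)`. -/
abbrev OrliczZeroForms (Φ : NFunction) := orliczSpace Φ zeroFormNorm area

/-- `L^Φ(ℍ², Λ¹)`, with the gauge norm. -/
abbrev OrliczOneForms (Φ : NFunction) := orliczSpace Φ oneFormNorm area

/-- `Z¹_Φ(ℍ²)`: the forms `ω ∈ L^Φ(ℍ², Λ¹)` with `dω = 0`. -/
def closedForms (Φ : NFunction) : Submodule ℝ (OrliczOneForms Φ) where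
  carrier := {ω | IsWeakDifferentialOne ((ω : HypPlane →ₘ[area] Covector) : HypPlane → Covector) 0}
  zero_mem' := by
    have h : IsWeakDifferentialOne 0 0 :=
      ⟨locallyIntegrable_const 0, locallyIntegrable_const 0, fun u _ _ => by simp [wedge]⟩
    exact h.congr (AEEqFun.coeFn_zero (β := Covector) (μ := area)).symm
  add_mem' {ω η} hω hη := by
    have h := hω.add hη
    rw [add_zero] at h
    exact h.congr (AEEqFun.coeFn_add (ω : HypPlane →ₘ[area] Covector) η).symm
  smul_mem' c ω hω := by
    have h := IsWeakDifferentialOne.smul hω c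
    rw [smul_zero] at h
    exact h.congr (AEEqFun.coeFn_smul c (ω : HypPlane →ₘ[area] Covector)).symm

/-- `B¹_{Φ₁,Φ₂}(ℍ²)`: the forms `ω ∈ L^{Φ₂}(ℍ², Λ¹)` with `ω = dβ` for some
`β ∈ L^{Φ₁}(ℍ², Λ⁰)`. -/
def exactForms (Φ₁ Φ₂ : NFunction) : Submodule ℝ (OrliczOneForms Φ₂) where
  carrier := {ω | ∃ β : OrliczZeroForms Φ₁,
    IsWeakDifferentialZero ((β : HypPlane →ₘ[area] ℝ) : HypPlane → ℝ)
      ((ω : HypPlane →ₘ[area] Covector) : HypPlane → Covector)}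
  zero_mem' := ⟨0, IsWeakDifferentialZero.zero.congr
    (AEEqFun.coeFn_zero (β := ℝ) (μ := area)).symm
    (AEEqFun.coeFn_zero (β := Covector) (μ := area)).symm⟩
  add_mem' := by
    rintro ω η ⟨β, hβ⟩ ⟨γ, hγ⟩
    exact ⟨β + γ, (hβ.add hγ).congr
      (AEEqFun.coeFn_add (β : HypPlane →ₘ[area] ℝ) γ).symm
      (AEEqFun.coeFn_add (ω : HypPlane →ₘ[area] Covector) η).symm⟩
  smul_mem' := by
    rintro c ω ⟨β, hβ⟩
    exact ⟨c • β, (hβ.smul c).congr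
      (AEEqFun.coeFn_smul c (β : HypPlane →ₘ[area] ℝ)).symm
      (AEEqFun.coeFn_smul c (ω : HypPlane →ₘ[area] Covector)).symm⟩

/-- The reduced `L_{Φ₁,Φ₂}`-cohomology of `ℍ²` in degree one: the quotient of `Z¹_{Φ₂}(ℍ²)` by the
closure of `B¹_{Φ₁,Φ₂}(ℍ²)` in `L^{Φ₂}(ℍ², Λ¹)`. -/
abbrev ReducedCohomologyOne (Φ₁ Φ₂ : NFunction) :=
  closedForms Φ₂ ⧸ (exactForms Φ₁ Φ₂).topologicalClosure.submoduleOf (closedForms Φ₂)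

end HypPlane

end

noncomputable section

/-! The lines `y = const`, `z → ∞`, end at distinct points of the circle at infinity, and a function
`f ∈ C_c^∞(ℝ)` is read as a boundary value there. With a smooth step `χ(z)`, the function `χ(z)
f(y)` has this boundary value. Unless `f = 0` it lies in no Orlicz space, since it does not decay
while the area density is `e^z`. Its differential does decay: `dy` has length `e^{-z}` and `χ'`
lives on `[0, 1]`, so `|d(χf)| ≤ C e^{-z}` on a sector `|y| ≤ R`, `z ≥ 0`. The modular of `e^{-z}`
there is a multiple of `∫ e^z Φ(e^{-z}) dz = ∫₀¹ Φ(v) v⁻² dv`, which is what condition (A) makes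
finite (`lintegral_sectorWeight_lt_top`).

Condition (A) is used three times. For `Φ₂` it puts `d(χf)` in `L^{Φ₂}`. For `Ψ₂`, through Hölder,
it makes `ω ↦ ∫ ω ∧ d(χg)` a continuous functional on `L^{Φ₂}` (`horoPairing`). For `Ψ₁` it makes `β
χ g'` integrable for `dy dz` whenever `β ∈ L^{Φ₁}`. Hence the boundary term at height `n` in the
integration by parts of `∫ dβ ∧ d(χg)` tends to `0`, and the functional kills exact forms
(`integral_wedge_horoForm_eq_zero`), so also their closure.

The functionals thus descend to the reduced cohomology, and on the class of `d(χf)` the value is `∫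
f' g dy` (`horoPairing_horoClass`). For disjointly supported bumps `f_n` and `g_m = f_m'` the matrix
of values is diagonal with positive diagonal, so the classes of `d(χf_n)` are linearly independent.
-/

theorem NFunction.mul_le_add_complementary (Φ : NFunction) {s t : ℝ} (hs : 0 ≤ s) (ht : 0 ≤ t) :
    s * t ≤ Φ s + Φ.complementary t := by
  have h := Φ.le_conjFun hs t
  rw [abs_of_nonneg ht] at h
  change s * t ≤ Φ s + Φ.conjFun t
  linarith

/-! ### Hölder's inequality for the gauge norm -/

section OrliczHolder

variable {X V : Type*} [TopologicalSpace X] [TopologicalSpace.PseudoMetrizableSpace X]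
  [SecondCountableTopology X] [MeasurableSpace X] [OpensMeasurableSpace X]
  [NormedAddCommGroup V] [NormedSpace ℝ V]

/-- Young's inequality is applied pointwise to `|ω| / K` and `w`; the modular of `ω / K` is at most
`1` by the choice of `K`. -/
theorem lintegral_norm_mul_le_of_mem_gaugeSet (Φ : NFunction) (N : FibreNorm X V) (μ : Measure X)
    {ω : X →ₘ[μ] V} {K : ℝ} (hK : K ∈ gaugeSet Φ N μ ω) {w : X → ℝ} (hw : ∀ x, 0 ≤ w x) :
    ∫⁻ x, ENNReal.ofReal (N.norm x (ω x) * w x) ∂μ ≤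
      ENNReal.ofReal K * (1 + ∫⁻ x, ENNReal.ofReal (Φ.complementary (w x)) ∂μ) := by
  have hK0 := hK.1
  have hm := hK.2
  rw [modular_smul, abs_of_pos (inv_pos.2 hK0)] at hm
  refine le_trans ?_ (mul_le_mul_right (add_le_add hm le_rfl) _)
  rw [← lintegral_add_left' (modular_aemeasurable Φ N μ ω K⁻¹),
    ← lintegral_const_mul' _ _ ENNReal.ofReal_ne_top]
  refine lintegral_mono fun x => ?_
  have h0 : 0 ≤ K⁻¹ * N.norm x (ω x) := mul_nonneg (inv_pos.2 hK0).le (apply_nonneg _ _)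
  have h := Φ.mul_le_add_complementary h0 (hw x)
  simp only
  rw [← ENNReal.ofReal_add (Φ.nonneg' _) (Φ.complementary.nonneg' _),
    ← ENNReal.ofReal_mul hK0.le]
  refine ENNReal.ofReal_le_ofReal ?_
  calc N.norm x (ω x) * w x = K * (K⁻¹ * N.norm x (ω x) * w x) := by field_simp
    _ ≤ _ := mul_le_mul_of_nonneg_left h hK0.le

/-- Hölder's inequality for the gauge norm against a weight of finite complementary modular. -/
theorem lintegral_norm_mul_le (Φ : NFunction) (N : FibreNorm X V) (μ : Measure X)
    (ω : orliczSpace Φ N μ) {w : X → ℝ} (hw : ∀ x, 0 ≤ w x)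
    (hM : ∫⁻ x, ENNReal.ofReal (Φ.complementary (w x)) ∂μ < ∞) :
    ∫⁻ x, ENNReal.ofReal (N.norm x ((ω : X →ₘ[μ] V) x) * w x) ∂μ ≤ ENNReal.ofReal
      (‖ω‖ * (1 + (∫⁻ x, ENNReal.ofReal (Φ.complementary (w x)) ∂μ).toReal)) := by
  set M := ∫⁻ x, ENNReal.ofReal (Φ.complementary (w x)) ∂μ
  set I := ∫⁻ x, ENNReal.ofReal (N.norm x ((ω : X →ₘ[μ] V) x) * w x) ∂μ
  have hM1 : 0 < 1 + M.toReal := by positivity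
  have key : ∀ K ∈ gaugeSet Φ N μ (ω : X →ₘ[μ] V), I ≤ ENNReal.ofReal (K * (1 + M.toReal)) := by
    intro K hK
    refine (lintegral_norm_mul_le_of_mem_gaugeSet Φ N μ hK hw).trans (le_of_eq ?_)
    rw [ENNReal.ofReal_mul hK.1.le, ENNReal.ofReal_add zero_le_one ENNReal.toReal_nonneg,
      ENNReal.ofReal_one, ENNReal.ofReal_toReal hM.ne]
  obtain ⟨K₀, hK₀⟩ := orliczSpace_gaugeSet_nonempty ω
  -- Finiteness allows passing to real numbers, where the bound can be divided by `1 + M` and the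
  -- infimum over `K` taken.
  have hI : I ≠ ∞ := ((key K₀ hK₀).trans_lt ENNReal.ofReal_lt_top).ne
  rw [← ENNReal.ofReal_toReal hI]
  refine ENNReal.ofReal_le_ofReal ?_
  rw [← div_le_iff₀ hM1]
  refine le_csInf ⟨K₀, hK₀⟩ fun K hK => ?_
  rw [div_le_iff₀ hM1]
  exact ENNReal.toReal_le_of_le_ofReal (mul_nonneg hK.1.le hM1.le) (key K hK)

end OrliczHolder

namespace HypPlane

/-! ### Condition (A) and integrals over horoball sectors -/

theorem lintegral_area (g : HypPlane → ℝ≥0∞) :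
    ∫⁻ p, g p ∂area = ∫⁻ p : HypPlane, ENNReal.ofReal (Real.exp p.2) * g p := by
  rw [area, lintegral_withDensity_eq_lintegral_mul_non_measurable]
  · rfl
  · fun_prop
  · exact Eventually.of_forall fun _ => ENNReal.ofReal_lt_top

/-- The function `e^{-z}` on the horoball sector `|y| ≤ R`, `z ≥ 0`, extended by zero. -/
def sectorWeight (R : ℝ) (p : HypPlane) : ℝ :=
  (Icc (-R) R).indicator 1 p.1 * (Ici (0 : ℝ)).indicator (fun z => Real.exp (-z)) p.2

theorem sectorWeight_nonneg (R : ℝ) (p : HypPlane) : 0 ≤ sectorWeight R p :=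
  mul_nonneg (indicator_nonneg (fun _ _ => zero_le_one) _)
    (indicator_nonneg (fun _ _ => (Real.exp_pos _).le) _)

/-- The substitution `v = e^{-z}` turns `dv / v²` into `e^z dz`: condition (A) says exactly that
`e^{-z}` has finite modular on a sector. -/
theorem lintegral_exp_mul_comp_exp_neg (Φ : NFunction) :
    ∫⁻ z in Ici (0 : ℝ), ENNReal.ofReal (Real.exp z * Φ (Real.exp (-z))) =
      ∫⁻ v in Ioc (0 : ℝ) 1, ENNReal.ofReal (Φ v / v ^ 2) := by
  have him : (fun z : ℝ => Real.exp (-z)) '' Ici 0 = Ioc 0 1 := by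
    ext v
    constructor
    · rintro ⟨z, hz, rfl⟩
      exact ⟨Real.exp_pos _, Real.exp_le_one_iff.2 (neg_nonpos.2 hz)⟩
    · rintro ⟨h0, h1⟩
      exact ⟨-Real.log v, neg_nonneg.2 (Real.log_nonpos h0.le h1), by simp [Real.exp_log h0]⟩
  rw [← him, lintegral_image_eq_lintegral_abs_deriv_mul measurableSet_Ici
    (f' := fun z => -Real.exp (-z))]
  · refine lintegral_congr fun z => ?_
    rw [← ENNReal.ofReal_mul (abs_nonneg _), abs_neg, abs_of_pos (Real.exp_pos _), Real.exp_neg]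
    congr 1
    have := Real.exp_pos z
    field_simp
  · intro z _
    simpa using ((hasDerivAt_neg z).exp).hasDerivWithinAt
  · exact (Real.exp_injective.comp neg_injective).injOn

theorem lintegral_sectorWeight_lt_top {Φ : NFunction} (h : Φ.ConditionA) (R : ℝ) :
    ∫⁻ p, ENNReal.ofReal (Φ (sectorWeight R p)) ∂area < ∞ := by
  have e : ∀ p : HypPlane, ENNReal.ofReal (Real.exp p.2) * ENNReal.ofReal (Φ (sectorWeight R p)) =
      (Icc (-R) R).indicator 1 p.1 * (Ici (0 : ℝ)).indicator
        (fun z => ENNReal.ofReal (Real.exp z * Φ (Real.exp (-z)))) p.2 := by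
    intro p
    by_cases h1 : p.1 ∈ Icc (-R) R <;> by_cases h2 : p.2 ∈ Ici (0 : ℝ) <;>
      simp [sectorWeight, h1, h2, Φ.map_zero, ENNReal.ofReal_mul (Real.exp_pos _).le]
  have hm : Measurable fun z : ℝ => ENNReal.ofReal (Real.exp z * Φ (Real.exp (-z))) := by
    have := Φ.continuous
    fun_prop
  rw [lintegral_area, lintegral_congr e, Measure.volume_eq_prod, lintegral_prod_mul
    (measurable_one.indicator measurableSet_Icc).aemeasurable
    (hm.indicator measurableSet_Ici).aemeasurable, lintegral_indicator measurableSet_Ici,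
    lintegral_exp_mul_comp_exp_neg, lintegral_indicator_one measurableSet_Icc]
  exact ENNReal.mul_lt_top (by simp) h

/-- The factor `e^z` in the hypothesis is the area density, so `|F| dy dz` is dominated by `C |ω|
e^{-z} dA` on the sector and Hölder applies. The constant in front of `‖ω‖` does not depend on `ω`.
The fibre is left general to cover both functions and `1`-forms. -/
theorem integrable_of_abs_le_sectorWeight {V : Type*} [NormedAddCommGroup V] [NormedSpace ℝ V]
    {Φ : NFunction} (hΨ : Φ.complementary.ConditionA) {N : FibreNorm HypPlane V}
    (ω : orliczSpace Φ N area) {F : HypPlane → ℝ} (hF : AEStronglyMeasurable F) {C R : ℝ}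
    (hC : 0 ≤ C)
    (h : ∀ p, |F p| ≤
      C * (Real.exp p.2 * (N.norm p ((ω : HypPlane →ₘ[area] V) p) * sectorWeight R p))) :
    Integrable F ∧ ∫ p, |F p| ≤ C * (1 + (∫⁻ p, ENNReal.ofReal
      (Φ.complementary (sectorWeight R p)) ∂area).toReal) * ‖ω‖ := by
  have hM := lintegral_sectorWeight_lt_top hΨ R
  have hle : ∫⁻ p, ENNReal.ofReal |F p| ≤ ENNReal.ofReal (C * (1 + (∫⁻ p, ENNReal.ofReal
      (Φ.complementary (sectorWeight R p)) ∂area).toReal) * ‖ω‖) := by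
    rw [mul_assoc, mul_comm (1 + _) ‖ω‖, ENNReal.ofReal_mul hC]
    refine le_trans ?_ (mul_le_mul_right
      (lintegral_norm_mul_le Φ N area ω (sectorWeight_nonneg R) hM) _)
    rw [lintegral_area, ← lintegral_const_mul' _ _ ENNReal.ofReal_ne_top]
    refine lintegral_mono fun p => ?_
    simp only
    rw [← ENNReal.ofReal_mul (Real.exp_pos _).le, ← ENNReal.ofReal_mul hC]
    exact ENNReal.ofReal_le_ofReal (h p)
  have hint : Integrable F := by
    refine ⟨hF, ?_⟩
    rw [hasFiniteIntegral_iff_norm]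
    exact hle.trans_lt ENNReal.ofReal_lt_top
  refine ⟨hint, ?_⟩
  rw [integral_eq_lintegral_of_nonneg_ae (Eventually.of_forall fun _ => abs_nonneg _)
    (by simpa using hF.norm)]
  exact ENNReal.toReal_le_of_le_ofReal (by positivity) hle

/-! ### The forms `d(χ f)` and their decay -/

/-- The function `χ(z) f(y)`, with `χ` a smooth step equal to `0` for `z ≤ 0` and to `1` for
`z ≥ 1`. -/
def horoPotential (f : ℝ → ℝ) (p : HypPlane) : ℝ := Real.smoothTransition p.2 * f p.1

/-- The differential of `χ(z) f(y)`. -/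
def horoForm (f : ℝ → ℝ) (p : HypPlane) : Covector := fderiv ℝ (horoPotential f) p

theorem contDiff_horoPotential {f : ℝ → ℝ} (hf : ContDiff ℝ (⊤ : ℕ∞) f) :
    ContDiff ℝ (⊤ : ℕ∞) (horoPotential f) :=
  (Real.smoothTransition.contDiff.comp contDiff_snd).mul (hf.comp contDiff_fst)

theorem contDiff_horoForm {f : ℝ → ℝ} (hf : ContDiff ℝ (⊤ : ℕ∞) f) :
    ContDiff ℝ (⊤ : ℕ∞) (horoForm f) :=
  (contDiff_horoPotential hf).fderiv_right (by simp)

theorem differentiable_smoothTransition : Differentiable ℝ Real.smoothTransition :=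
  (Real.smoothTransition.contDiff (n := 1)).differentiable (by simp)

theorem continuous_deriv_smoothTransition : Continuous (deriv Real.smoothTransition) :=
  (Real.smoothTransition.contDiff (n := 1)).continuous_deriv le_rfl

theorem deriv_smoothTransition_eq_zero {z : ℝ} (hz : z ∉ Icc (0 : ℝ) 1) :
    deriv Real.smoothTransition z = 0 := by
  rcases not_and_or.1 hz with h | h
  · have : Real.smoothTransition =ᶠ[𝓝 z] fun _ => 0 := by
      filter_upwards [eventually_lt_nhds (not_le.1 h)] with x hx
      exact Real.smoothTransition.zero_of_nonpos hx.le
    rw [this.deriv_eq, deriv_const]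
  · have : Real.smoothTransition =ᶠ[𝓝 z] fun _ => 1 := by
      filter_upwards [eventually_gt_nhds (not_le.1 h)] with x hx
      exact Real.smoothTransition.one_of_one_le hx.le
    rw [this.deriv_eq, deriv_const]

theorem hasCompactSupport_deriv_smoothTransition :
    HasCompactSupport (deriv Real.smoothTransition) :=
  HasCompactSupport.intro isCompact_Icc fun _ hz => deriv_smoothTransition_eq_zero hz

theorem hasFDerivAt_horoPotential {f : ℝ → ℝ} (hf : Differentiable ℝ f) (p : HypPlane) :
    HasFDerivAt (horoPotential f)
      (Real.smoothTransition p.2 • (deriv f p.1 • ContinuousLinearMap.fst ℝ ℝ ℝ) +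
        f p.1 • (deriv Real.smoothTransition p.2 • ContinuousLinearMap.snd ℝ ℝ ℝ)) p :=
  ((differentiable_smoothTransition p.2).hasDerivAt.comp_hasFDerivAt p hasFDerivAt_snd).mul
    ((hf p.1).hasDerivAt.comp_hasFDerivAt p hasFDerivAt_fst)

theorem horoForm_ey {f : ℝ → ℝ} (hf : Differentiable ℝ f) (p : HypPlane) :
    horoForm f p ey = Real.smoothTransition p.2 * deriv f p.1 := by
  simp [horoForm, (hasFDerivAt_horoPotential hf p).fderiv, ey]

theorem horoForm_ez {f : ℝ → ℝ} (hf : Differentiable ℝ f) (p : HypPlane) :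
    horoForm f p ez = f p.1 * deriv Real.smoothTransition p.2 := by
  simp [horoForm, (hasFDerivAt_horoPotential hf p).fderiv, ez]

theorem exists_bound_of_hasCompactSupport {f : ℝ → ℝ} (hf : Continuous f)
    (hc : HasCompactSupport f) : ∃ A, 0 ≤ A ∧ ∀ x, |f x| ≤ A := by
  obtain ⟨A, hA⟩ := hc.exists_bound_of_continuous hf
  exact ⟨A, (norm_nonneg _).trans (hA 0), hA⟩

theorem exists_eq_zero_of_notMem_Icc {f : ℝ → ℝ} (hc : HasCompactSupport f) :
    ∃ R : ℝ, ∀ y ∉ Icc (-R) R, f y = 0 ∧ deriv f y = 0 := by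
  obtain ⟨R, hR⟩ := hc.isBounded.subset_closedBall 0
  rw [Real.closedBall_eq_Icc, zero_sub, zero_add] at hR
  refine ⟨R, fun y hy => ⟨image_eq_zero_of_notMem_tsupport fun h => hy (hR h), ?_⟩⟩
  by_contra h
  exact hy (hR (support_deriv_subset h))

/-- The `dy` part decays because `dy` has length `e^{-z}`, the `dz` part because it lives on `0 ≤ z
≤ 1`. The components are bounded separately since the boundary term for exact forms involves the
`dy` coefficient alone. -/
theorem exists_horoForm_bounds {f : ℝ → ℝ} (hf : ContDiff ℝ (⊤ : ℕ∞) f)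
    (hc : HasCompactSupport f) : ∃ C R : ℝ, 0 < C ∧ ∀ p,
      Real.exp (-p.2) * |horoForm f p ey| ≤ C * sectorWeight R p ∧
      |horoForm f p ez| ≤ C * sectorWeight R p := by
  have hd : Differentiable ℝ f := hf.differentiable (by simp)
  obtain ⟨A, hA0, hA⟩ := exists_bound_of_hasCompactSupport (hf.continuous_deriv (by simp)) hc.deriv
  obtain ⟨D, hD0, hD⟩ := exists_bound_of_hasCompactSupport hf.continuous hc
  obtain ⟨B, hB0, hB⟩ := exists_bound_of_hasCompactSupport continuous_deriv_smoothTransition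
    hasCompactSupport_deriv_smoothTransition
  obtain ⟨R, hR⟩ := exists_eq_zero_of_notMem_Icc hc
  -- `A` bounds `f'` and `D * B` bounds `f χ'`; the factor `e` makes up for `e^{-z} ≥ e⁻¹` on `[0,
  -- 1]`, and `+ 1` makes the constant positive, hence invertible.
  refine ⟨A + D * B * Real.exp 1 + 1, R, by positivity, fun p => ?_⟩
  have hpos : 0 ≤ (A + D * B * Real.exp 1 + 1) * sectorWeight R p :=
    mul_nonneg (by positivity) (sectorWeight_nonneg R p)
  rw [horoForm_ey hd, horoForm_ez hd]
  by_cases h1 : p.1 ∈ Icc (-R) R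
  · by_cases h2 : p.2 ∈ Ici (0 : ℝ)
    · have hw : sectorWeight R p = Real.exp (-p.2) := by simp [sectorWeight, h1, h2]
      have hE := Real.exp_pos (-p.2)
      rw [hw]
      constructor
      · have h3 : |Real.smoothTransition p.2 * deriv f p.1| ≤ A := by
          rw [abs_mul, abs_of_nonneg (Real.smoothTransition.nonneg _)]
          exact (mul_le_of_le_one_left (abs_nonneg _) (Real.smoothTransition.le_one _)).trans
            (hA _)
        have h4 : 0 ≤ D * B * Real.exp 1 := by positivity
        rw [mul_comm]
        exact mul_le_mul_of_nonneg_right (by linarith) hE.le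
      · by_cases h3 : p.2 ∈ Icc (0 : ℝ) 1
        · have h4 : |f p.1 * deriv Real.smoothTransition p.2| ≤ D * B := by
            rw [abs_mul]
            exact mul_le_mul (hD _) (hB _) (abs_nonneg _) hD0
          have h5 : 1 ≤ Real.exp 1 * Real.exp (-p.2) := by
            rw [← Real.exp_add]
            exact Real.one_le_exp (by linarith [h3.2])
          have h6 : D * B ≤ D * B * (Real.exp 1 * Real.exp (-p.2)) :=
            le_mul_of_one_le_right (by positivity) h5
          have h7 : 0 ≤ (A + 1) * Real.exp (-p.2) := by positivity
          linarith
        · rw [deriv_smoothTransition_eq_zero h3, mul_zero, abs_zero]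
          positivity
    · have h3 : p.2 < 0 := not_le.1 h2
      rw [Real.smoothTransition.zero_of_nonpos h3.le,
        deriv_smoothTransition_eq_zero fun h => h2 h.1]
      simpa using hpos
  · obtain ⟨h3, h4⟩ := hR _ h1
    rw [h3, h4]
    simpa using hpos

theorem covectorLength_le (p : HypPlane) (ξ : Covector) :
    covectorLength p ξ ≤ Real.exp (-p.2) * |ξ ey| + |ξ ez| := by
  have hE := Real.exp_pos (-p.2)
  refine Real.sqrt_le_iff.2 ⟨by positivity, ?_⟩
  have h : 0 ≤ Real.exp (-p.2) * |ξ ey| * |ξ ez| := by positivity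
  rw [mul_pow, ← sq_abs (ξ ey), ← sq_abs (ξ ez)]
  nlinarith

/-- In the orthonormal coframe `e^z dy`, `dz` the wedge is a `2 × 2` determinant times the area
density `e^z`. -/
theorem abs_wedge_le (p : HypPlane) (ξ η : Covector) :
    |wedge ξ η| ≤ Real.exp p.2 * (covectorLength p ξ * covectorLength p η) := by
  have hE : Real.exp p.2 * Real.exp (-p.2) = 1 := by rw [← Real.exp_add]; simp
  have e : wedge ξ η = Real.exp p.2 *
      ((Real.exp (-p.2) * ξ ey) * η ez - ξ ez * (Real.exp (-p.2) * η ey)) := by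
    rw [wedge]
    linear_combination (-(ξ ey * η ez - ξ ez * η ey)) * hE
  rw [e, abs_mul, abs_of_pos (Real.exp_pos _)]
  refine mul_le_mul_of_nonneg_left ?_ (Real.exp_pos _).le
  rw [covectorLength, covectorLength, ← Real.sqrt_mul (by positivity)]
  refine Real.abs_le_sqrt ?_
  -- Lagrange's identity: the product of the squared lengths is the squared determinant plus this
  -- squared inner product.
  nlinarith [sq_nonneg ((Real.exp (-p.2) * ξ ey) * (Real.exp (-p.2) * η ey) + ξ ez * η ez)]

theorem covectorLength_nonneg (p : HypPlane) (ξ : Covector) : 0 ≤ covectorLength p ξ :=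
  Real.sqrt_nonneg _

theorem exists_covectorLength_horoForm_le {f : ℝ → ℝ} (hf : ContDiff ℝ (⊤ : ℕ∞) f)
    (hc : HasCompactSupport f) : ∃ C R : ℝ, 0 < C ∧ ∀ p,
      covectorLength p (horoForm f p) ≤ C * sectorWeight R p := by
  obtain ⟨C, R, hC, h⟩ := exists_horoForm_bounds hf hc
  refine ⟨2 * C, R, by positivity, fun p => (covectorLength_le p _).trans ?_⟩
  linarith [(h p).1, (h p).2]

/-! ### The continuous functionals `ω ↦ ∫ ω ∧ d(χ g)` -/

theorem aestronglyMeasurable_wedge {ω : HypPlane → Covector} {θ : HypPlane → Covector}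
    (hω : AEStronglyMeasurable ω) (hθ : Continuous θ) :
    AEStronglyMeasurable fun p => wedge (ω p) (θ p) := by
  have : Continuous fun q : Covector × Covector => wedge q.1 q.2 := by
    unfold wedge
    fun_prop
  exact this.comp_aestronglyMeasurable (hω.prodMk hθ.aestronglyMeasurable)

theorem aestronglyMeasurable_coeFn {V : Type*} [NormedAddCommGroup V]
    (ω : HypPlane →ₘ[area] V) : AEStronglyMeasurable (ω : HypPlane → V) :=
  ω.aestronglyMeasurable.mono_ac volume_absolutelyContinuous_area

theorem exists_wedge_horoForm_bound {Φ : NFunction} (hΨ : Φ.complementary.ConditionA) {g : ℝ → ℝ}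
    (hg : ContDiff ℝ (⊤ : ℕ∞) g) (hc : HasCompactSupport g) :
    ∃ M : ℝ, ∀ ω : OrliczOneForms Φ,
      Integrable (fun p => wedge ((ω : HypPlane →ₘ[area] Covector) p) (horoForm g p)) ∧
      ∫ p, |wedge ((ω : HypPlane →ₘ[area] Covector) p) (horoForm g p)| ≤ M * ‖ω‖ := by
  obtain ⟨C, R, hC, h⟩ := exists_covectorLength_horoForm_le hg hc
  refine ⟨_, fun ω => integrable_of_abs_le_sectorWeight (R := R) hΨ ω
    (aestronglyMeasurable_wedge (aestronglyMeasurable_coeFn _) (contDiff_horoForm hg).continuous)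
    hC.le fun p => ?_⟩
  refine (abs_wedge_le p _ _).trans ?_
  have h1 := mul_le_mul_of_nonneg_left (h p)
    (covectorLength_nonneg p ((ω : HypPlane →ₘ[area] Covector) p))
  calc _ ≤ Real.exp p.2 * (covectorLength p ((ω : HypPlane →ₘ[area] Covector) p) *
        (C * sectorWeight R p)) := mul_le_mul_of_nonneg_left h1 (Real.exp_pos _).le
    _ = C * (Real.exp p.2 * (covectorLength p ((ω : HypPlane →ₘ[area] Covector) p) *
        sectorWeight R p)) := by ring

/-- The functional `ω ↦ ∫ ω ∧ d(χ g)` on `L^Φ(ℍ², Λ¹)`. -/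
def horoPairing {Φ : NFunction} (hΨ : Φ.complementary.ConditionA) {g : ℝ → ℝ}
    (hg : ContDiff ℝ (⊤ : ℕ∞) g) (hc : HasCompactSupport g) : OrliczOneForms Φ →L[ℝ] ℝ :=
  LinearMap.mkContinuousOfExistsBound
    { toFun := fun ω => ∫ p, wedge ((ω : HypPlane →ₘ[area] Covector) p) (horoForm g p)
      map_add' := by
        intro ω η
        obtain ⟨M, hM⟩ := exists_wedge_horoForm_bound hΨ hg hc
        rw [← integral_add (hM ω).1 (hM η).1]
        refine integral_congr_ae ?_
        filter_upwards [volume_absolutelyContinuous_area.ae_le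
          (AEEqFun.coeFn_add (ω : HypPlane →ₘ[area] Covector) η)] with p hp
        rw [Submodule.coe_add, hp, Pi.add_apply, wedge_add_left]
      map_smul' := by
        intro c ω
        rw [RingHom.id_apply, smul_eq_mul, ← integral_const_mul]
        refine integral_congr_ae ?_
        filter_upwards [volume_absolutelyContinuous_area.ae_le
          (AEEqFun.coeFn_smul c (ω : HypPlane →ₘ[area] Covector))] with p hp
        rw [Submodule.coe_smul, hp, Pi.smul_apply, wedge_smul_left] }
    (by
      obtain ⟨M, hM⟩ := exists_wedge_horoForm_bound hΨ hg hc
      exact ⟨M, fun ω => norm_integral_le_integral_norm _ |>.trans (hM ω).2⟩)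

theorem horoPairing_apply {Φ : NFunction} (hΨ : Φ.complementary.ConditionA) {g : ℝ → ℝ}
    (hg : ContDiff ℝ (⊤ : ℕ∞) g) (hc : HasCompactSupport g) (ω : OrliczOneForms Φ) :
    horoPairing hΨ hg hc ω =
      ∫ p, wedge ((ω : HypPlane →ₘ[area] Covector) p) (horoForm g p) := rfl

/-! ### The functionals vanish on the closure of the exact forms -/

theorem dOneForm_fderiv {F : HypPlane → ℝ} (hF : ContDiff ℝ (⊤ : ℕ∞) F) (p : HypPlane) :
    dOneForm (fderiv ℝ F) p = 0 := by
  have h : IsSymmSndFDerivAt ℝ F p :=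
    (hF.contDiffAt).isSymmSndFDerivAt (by
      rw [minSmoothness_of_isRCLikeNormedField]
      exact WithTop.coe_le_coe.2 (le_top : (2 : ℕ∞) ≤ ⊤))
  exact sub_eq_zero.2 (h.eq ey ez)

theorem dOneForm_smul {c : HypPlane → ℝ} {θ : HypPlane → Covector} {p : HypPlane}
    (hc : DifferentiableAt ℝ c p) (hθ : DifferentiableAt ℝ θ p) :
    dOneForm (fun q => c q • θ q) p = c p * dOneForm θ p + wedge (fderiv ℝ c p) (θ p) := by
  rw [dOneForm, dOneForm, wedge, fderiv_fun_smul hc hθ]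
  simp only [add_apply, smul_apply, ContinuousLinearMap.smulRight_apply, smul_eq_mul]
  ring

theorem smoothTransition_eventually_eq_one (z : ℝ) :
    ∀ᶠ n : ℕ in atTop, Real.smoothTransition (n + 1 - z) = 1 ∧
      deriv Real.smoothTransition (n + 1 - z) = 0 := by
  -- The strict inequality `n > z` puts `n + 1 - z` outside the closed interval `[0, 1]`, where the
  -- derivative is known to vanish.
  filter_upwards [tendsto_natCast_atTop_atTop.eventually_gt_atTop z] with n hn
  exact ⟨Real.smoothTransition.one_of_one_le (by linarith),
    deriv_smoothTransition_eq_zero fun h => by linarith [h.2]⟩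

/-- As `d(χg)` is closed, only the differential `-χ'(a - z) dz` of the cutoff contributes, and its
wedge with a form sees just the `dy` coefficient. -/
theorem dOneForm_cutoff_horoForm {g : ℝ → ℝ} (hg : ContDiff ℝ (⊤ : ℕ∞) g) (a : ℝ) (p : HypPlane) :
    dOneForm (fun q => Real.smoothTransition (a - q.2) • horoForm g q) p =
      deriv Real.smoothTransition (a - p.2) * horoForm g p ey := by
  have hd : HasFDerivAt (fun q : HypPlane => Real.smoothTransition (a - q.2))
      (deriv Real.smoothTransition (a - p.2) • (-ContinuousLinearMap.snd ℝ ℝ ℝ)) p :=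
    (differentiable_smoothTransition _).hasDerivAt.comp_hasFDerivAt p (hasFDerivAt_snd.const_sub a)
  rw [dOneForm_smul hd.differentiableAt ((contDiff_horoForm hg).differentiable (by simp) p),
    hd.fderiv]
  have : dOneForm (horoForm g) p = 0 := dOneForm_fderiv (contDiff_horoPotential hg) p
  rw [this, wedge]
  simp [ey, ez]

/-- The form vanishes below `z = 0`, the cutoff above `z = a`, and `g` bounds the support in `y`.
This makes the product an admissible test form. -/
theorem hasCompactSupport_cutoff_horoForm {g : ℝ → ℝ} (hg : ContDiff ℝ (⊤ : ℕ∞) g)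
    (hc : HasCompactSupport g) (a : ℝ) :
    HasCompactSupport fun q : HypPlane => Real.smoothTransition (a - q.2) • horoForm g q := by
  have hd : Differentiable ℝ g := hg.differentiable (by simp)
  obtain ⟨R, hR⟩ := exists_eq_zero_of_notMem_Icc hc
  refine HasCompactSupport.intro ((isCompact_Icc (a := -R) (b := R)).prod
    (isCompact_Icc (a := (0 : ℝ)) (b := a))) fun p hp => ?_
  have key : p.1 ∉ Icc (-R) R ∨ p.2 < 0 ∨ a < p.2 := by
    by_contra! h
    exact hp ⟨h.1, h.2⟩
  rcases key with h | h | h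
  · have h0 : horoForm g p = 0 := by
      refine ContinuousLinearMap.ext fun v => ?_
      rw [covector_apply, horoForm_ey hd, horoForm_ez hd, (hR _ h).1, (hR _ h).2]
      simp
    rw [h0, smul_zero]
  · have h0 : horoForm g p = 0 := by
      refine ContinuousLinearMap.ext fun v => ?_
      rw [covector_apply, horoForm_ey hd, horoForm_ez hd,
        Real.smoothTransition.zero_of_nonpos h.le,
        deriv_smoothTransition_eq_zero fun h' => absurd h'.1 (not_le.2 h)]
      simp
    rw [h0, smul_zero]
  · rw [Real.smoothTransition.zero_of_nonpos (by linarith), zero_smul]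

theorem wedge_smul_right (c : ℝ) (ξ ζ : Covector) : wedge ξ (c • ζ) = c * wedge ξ ζ := by
  simp only [wedge, smul_apply, smul_eq_mul]; ring

/-- The definition of `ω = dβ` is tested on `χ(n + 1 - z) d(χg)`. As `n → ∞` the side with `ω` tends
to the pairing, by (A) for `Ψ₂`. The side with `β` is an integral of the integrable function `β χ
g'` over the strip `n ≤ z ≤ n + 1`, up to a bounded factor, and tends to `0`, by (A) for `Ψ₁`. -/
theorem integral_wedge_horoForm_eq_zero {Φ₁ Φ₂ : NFunction} (hΨ₁ : Φ₁.complementary.ConditionA)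
    (hΨ₂ : Φ₂.complementary.ConditionA) {g : ℝ → ℝ} (hg : ContDiff ℝ (⊤ : ℕ∞) g)
    (hc : HasCompactSupport g) (β : OrliczZeroForms Φ₁) (ω : OrliczOneForms Φ₂)
    (h : IsWeakDifferentialZero ((β : HypPlane →ₘ[area] ℝ) : HypPlane → ℝ)
      ((ω : HypPlane →ₘ[area] Covector) : HypPlane → Covector)) :
    ∫ p, wedge ((ω : HypPlane →ₘ[area] Covector) p) (horoForm g p) = 0 := by
  set b : HypPlane → ℝ := ((β : HypPlane →ₘ[area] ℝ) : HypPlane → ℝ)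
  set w : HypPlane → Covector := ((ω : HypPlane →ₘ[area] Covector) : HypPlane → Covector)
  have hb : AEStronglyMeasurable b := aestronglyMeasurable_coeFn _
  have hθ := (contDiff_horoForm hg).continuous
  have hχ := continuous_deriv_smoothTransition
  obtain ⟨B, hB0, hB⟩ := exists_bound_of_hasCompactSupport hχ
    hasCompactSupport_deriv_smoothTransition
  obtain ⟨C, R, hC, hCR⟩ := exists_horoForm_bounds hg hc
  -- The coefficient itself does not decay; written this way, the bound displays the area density
  -- needed for Hölder.
  have hy : ∀ p, |horoForm g p ey| ≤ Real.exp p.2 * (C * sectorWeight R p) := by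
    intro p
    have h1 := mul_le_mul_of_nonneg_left (hCR p).1 (Real.exp_pos p.2).le
    rwa [← mul_assoc, ← Real.exp_add, add_neg_cancel, Real.exp_zero, one_mul] at h1
  have hi1 : Integrable fun p => b p * horoForm g p ey := by
    refine (integrable_of_abs_le_sectorWeight (R := R) hΨ₁ β (hb.mul
      (by fun_prop : Continuous fun p => horoForm g p ey).aestronglyMeasurable) hC.le
      fun p => ?_).1
    change |b p * horoForm g p ey| ≤ C * (Real.exp p.2 * (|b p| * sectorWeight R p))
    rw [abs_mul]
    calc |b p| * |horoForm g p ey| ≤ |b p| * (Real.exp p.2 * (C * sectorWeight R p)) :=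
          mul_le_mul_of_nonneg_left (hy p) (abs_nonneg _)
      _ = _ := by ring
  have hi2 : Integrable fun p => wedge (w p) (horoForm g p) :=
    ((exists_wedge_horoForm_bound hΨ₂ hg hc).choose_spec ω).1
  have hn : ∀ n : ℕ, ∫ p : HypPlane, deriv Real.smoothTransition (n + 1 - p.2) *
      (b p * horoForm g p ey) =
      -∫ p : HypPlane, Real.smoothTransition (n + 1 - p.2) * wedge (w p) (horoForm g p) := by
    intro n
    have h1 := h.2.2 (fun q => Real.smoothTransition (n + 1 - q.2) • horoForm g q)
      ((Real.smoothTransition.contDiff.comp (contDiff_const.sub contDiff_snd)).smul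
        (contDiff_horoForm hg)) (hasCompactSupport_cutoff_horoForm hg hc _)
    simp only [dOneForm_cutoff_horoForm hg, wedge_smul_right] at h1
    rw [← h1]
    exact integral_congr_ae (Eventually.of_forall fun p => by simp only; ring)
  have hl1 : Tendsto (fun n : ℕ => ∫ p : HypPlane, deriv Real.smoothTransition (n + 1 - p.2) *
      (b p * horoForm g p ey)) atTop (𝓝 (∫ _ : HypPlane, (0 : ℝ))) := by
    refine tendsto_integral_of_dominated_convergence
      (fun p => B * |b p * horoForm g p ey|) (fun n => ?_) (hi1.abs.const_mul B)
      (fun n => Eventually.of_forall fun p => ?_) (Eventually.of_forall fun p => ?_)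
    · exact (by fun_prop : Continuous fun p : HypPlane =>
        deriv Real.smoothTransition (n + 1 - p.2)).aestronglyMeasurable.mul hi1.1
    · rw [Real.norm_eq_abs, abs_mul]
      exact mul_le_mul_of_nonneg_right (hB _) (abs_nonneg _)
    · refine tendsto_const_nhds.congr' ?_
      filter_upwards [smoothTransition_eventually_eq_one p.2] with n hn
      rw [hn.2, zero_mul]
  have hl2 : Tendsto (fun n : ℕ => ∫ p : HypPlane, Real.smoothTransition (n + 1 - p.2) *
      wedge (w p) (horoForm g p)) atTop (𝓝 (∫ p, wedge (w p) (horoForm g p))) := by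
    refine tendsto_integral_of_dominated_convergence
      (fun p => |wedge (w p) (horoForm g p)|) (fun n => ?_) hi2.abs
      (fun n => Eventually.of_forall fun p => ?_) (Eventually.of_forall fun p => ?_)
    · exact (Real.smoothTransition.continuous.comp
        (continuous_const.sub continuous_snd)).aestronglyMeasurable.mul hi2.1
    · rw [Real.norm_eq_abs, abs_mul, abs_of_nonneg (Real.smoothTransition.nonneg _)]
      exact mul_le_of_le_one_left (abs_nonneg _) (Real.smoothTransition.le_one _)
    · refine tendsto_const_nhds.congr' ?_
      filter_upwards [smoothTransition_eventually_eq_one p.2] with n hn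
      rw [hn.1, one_mul]
  simp only [hn, integral_zero] at hl1
  simpa using tendsto_nhds_unique hl2.neg hl1

theorem topologicalClosure_exactForms_le_ker {Φ₁ Φ₂ : NFunction}
    (hΨ₁ : Φ₁.complementary.ConditionA) (hΨ₂ : Φ₂.complementary.ConditionA) {g : ℝ → ℝ}
    (hg : ContDiff ℝ (⊤ : ℕ∞) g) (hc : HasCompactSupport g) :
    (exactForms Φ₁ Φ₂).topologicalClosure ≤ (horoPairing hΨ₂ hg hc).ker :=
  Submodule.topologicalClosure_minimal _
    (fun ω ⟨β, hβ⟩ => integral_wedge_horoForm_eq_zero hΨ₁ hΨ₂ hg hc β ω hβ)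
    (horoPairing hΨ₂ hg hc).isClosed_ker

/-! ### The closed forms `d(χ f)` as elements of the Orlicz space -/

theorem mk_mem_orliczSpace {Φ : NFunction} (hΦ : Φ.ConditionA) {f : ℝ → ℝ}
    (hf : ContDiff ℝ (⊤ : ℕ∞) f) (hc : HasCompactSupport f) :
    AEEqFun.mk (horoForm f) (contDiff_horoForm hf).continuous.aestronglyMeasurable ∈
      orliczSpace Φ oneFormNorm area := by
  obtain ⟨C, R, hC, h⟩ := exists_covectorLength_horoForm_le hf hc
  -- After scaling by `C⁻¹` the length is at most the sector weight itself, so no doubling condition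
  -- on `Φ` is needed.
  refine ⟨C⁻¹, inv_pos.2 hC, ?_⟩
  rw [modular_smul, abs_of_pos (inv_pos.2 hC)]
  refine lt_of_le_of_lt (lintegral_mono_ae ?_) (lintegral_sectorWeight_lt_top hΦ R)
  filter_upwards [AEEqFun.coeFn_mk (μ := area) (horoForm f)
    (contDiff_horoForm hf).continuous.aestronglyMeasurable] with p hp
  rw [hp]
  refine ENNReal.ofReal_le_ofReal (Φ.mono
    (mul_nonneg (inv_pos.2 hC).le (covectorLength_nonneg p _)) ?_)
  exact (inv_mul_le_iff₀ hC).2 (h p)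

/-- The class of the form `d(χ f)` in `L^Φ(ℍ², Λ¹)`. -/
def horoClass {Φ : NFunction} (hΦ : Φ.ConditionA) {f : ℝ → ℝ}
    (hf : ContDiff ℝ (⊤ : ℕ∞) f) (hc : HasCompactSupport f) : OrliczOneForms Φ :=
  ⟨_, mk_mem_orliczSpace hΦ hf hc⟩

theorem coeFn_horoClass {Φ : NFunction} (hΦ : Φ.ConditionA) {f : ℝ → ℝ}
    (hf : ContDiff ℝ (⊤ : ℕ∞) f) (hc : HasCompactSupport f) :
    ((horoClass hΦ hf hc : HypPlane →ₘ[area] Covector) : HypPlane → Covector) =ᵐ[area]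
      horoForm f :=
  AEEqFun.coeFn_mk _ _

/-- Integration by parts moves the derivatives from `F` to the compactly supported `u`, and the
mixed second derivatives of `u` cancel. -/
theorem isWeakDifferentialOne_fderiv {F : HypPlane → ℝ} (hF : ContDiff ℝ (⊤ : ℕ∞) F) :
    IsWeakDifferentialOne (fderiv ℝ F) 0 := by
  have hFc : Continuous F := hF.continuous
  have hF' : Continuous (fderiv ℝ F) := hF.continuous_fderiv (by simp)
  refine ⟨hF'.locallyIntegrable, locallyIntegrable_const 0, fun u hu hc => ?_⟩
  have hu' : ContDiff ℝ (⊤ : ℕ∞) (fderiv ℝ u) := hu.fderiv_right (by simp)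
  have hu'' : Continuous (fderiv ℝ (fderiv ℝ u)) := hu'.continuous_fderiv (by simp)
  have huc : Continuous (fderiv ℝ u) := hu'.continuous
  have hcf : ∀ v, HasCompactSupport fun p => fderiv ℝ u p v := fun v =>
    hasCompactSupport_clm_apply (hc.fderiv ℝ) v
  have hd : ∀ v p, HasFDerivAt (fun q => fderiv ℝ u q v) ((fderiv ℝ (fderiv ℝ u) p).flip v) p := by
    intro v p
    exact (((hu'.differentiable (by simp)) p).hasFDerivAt.clm_apply
      (hasFDerivAt_const v p)).congr_fderiv
      (ContinuousLinearMap.ext fun w => by simp)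
  have hibp : ∀ v w : HypPlane, ∫ p, fderiv ℝ F p w * fderiv ℝ u p v =
      -∫ p, F p * fderiv ℝ (fderiv ℝ u) p w v := by
    intro v w
    have h := integral_mul_fderiv_eq_neg_fderiv_mul_of_integrable (μ := (volume : Measure HypPlane))
      (f := F) (g := fun p => fderiv ℝ u p v) (v := w) ?_ ?_ ?_
      (fun p _ => hF.differentiable (by simp) p) (fun p _ => (hd v p).differentiableAt)
    · simp only [(hd v _).fderiv, ContinuousLinearMap.flip_apply] at h
      rw [h, neg_neg]
    · exact Continuous.integrable_of_hasCompactSupport (by fun_prop) ((hcf v).mul_left)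
    · simp only [(hd v _).fderiv, ContinuousLinearMap.flip_apply]
      exact Continuous.integrable_of_hasCompactSupport (by fun_prop)
        ((hasCompactSupport_clm_apply (hasCompactSupport_clm_apply
          ((hc.fderiv ℝ).fderiv ℝ) w) v).mul_left)
    · exact Continuous.integrable_of_hasCompactSupport (by fun_prop) ((hcf v).mul_left)
  have hi : ∀ v w : HypPlane, Integrable fun p => fderiv ℝ F p w * fderiv ℝ u p v := fun v w =>
    Continuous.integrable_of_hasCompactSupport (by fun_prop) ((hcf v).mul_left)
  simp only [wedge]
  rw [integral_sub (hi ez ey) (hi ey ez), hibp, hibp]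
  have hs : ∀ p, fderiv ℝ (fderiv ℝ u) p ey ez = fderiv ℝ (fderiv ℝ u) p ez ey := fun p =>
    sub_eq_zero.1 (dOneForm_fderiv hu p)
  simp [hs]

theorem horoClass_mem_closedForms {Φ : NFunction} (hΦ : Φ.ConditionA) {f : ℝ → ℝ}
    (hf : ContDiff ℝ (⊤ : ℕ∞) f) (hc : HasCompactSupport f) :
    horoClass hΦ hf hc ∈ closedForms Φ :=
  (isWeakDifferentialOne_fderiv (contDiff_horoPotential hf)).congr (coeFn_horoClass hΦ hf hc).symm

/-! ### Values of the pairing -/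

theorem integral_smoothTransition_mul_deriv :
    ∫ z, Real.smoothTransition z * deriv Real.smoothTransition z = 1 / 2 := by
  have hd : ∀ z, HasDerivAt (fun z => Real.smoothTransition z ^ 2 / 2)
      (Real.smoothTransition z * deriv Real.smoothTransition z) z := fun z =>
    (((differentiable_smoothTransition z).hasDerivAt.pow 2).div_const 2).congr_deriv
      (by norm_num; ring)
  rw [integral_of_hasDerivAt_of_tendsto (m := 0) (n := 1 / 2) hd]
  · simp
  · exact Continuous.integrable_of_hasCompactSupport
      (Real.smoothTransition.continuous.mul continuous_deriv_smoothTransition)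
      hasCompactSupport_deriv_smoothTransition.mul_left
  · refine tendsto_const_nhds.congr' ?_
    filter_upwards [eventually_le_atBot 0] with z hz
    simp [Real.smoothTransition.zero_of_nonpos hz]
  · refine tendsto_const_nhds.congr' ?_
    filter_upwards [eventually_ge_atTop 1] with z hz
    simp [Real.smoothTransition.one_of_one_le hz]

/-- The integrand separates as `(f' g - f g')(y) · (χ χ')(z)`. Integration by parts in `y` doubles
`∫ f' g`, and `∫ χ χ' = 1/2` removes the factor. -/
theorem horoPairing_horoClass {Φ : NFunction} (hΦ : Φ.ConditionA)
    (hΨ : Φ.complementary.ConditionA) {f g : ℝ → ℝ}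
    (hf : ContDiff ℝ (⊤ : ℕ∞) f) (hcf : HasCompactSupport f)
    (hg : ContDiff ℝ (⊤ : ℕ∞) g) (hcg : HasCompactSupport g) :
    horoPairing hΨ hg hcg (horoClass hΦ hf hcf) = ∫ y, deriv f y * g y := by
  have hdf : Differentiable ℝ f := hf.differentiable (by simp)
  have hdg : Differentiable ℝ g := hg.differentiable (by simp)
  have hf' : Continuous (deriv f) := hf.continuous_deriv (by simp)
  have hg' : Continuous (deriv g) := hg.continuous_deriv (by simp)
  have e : ∫ p, wedge ((horoClass hΦ hf hcf : HypPlane →ₘ[area] Covector) p) (horoForm g p) =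
      ∫ p : ℝ × ℝ, (deriv f p.1 * g p.1 - f p.1 * deriv g p.1) *
        (Real.smoothTransition p.2 * deriv Real.smoothTransition p.2) := by
    refine integral_congr_ae ?_
    filter_upwards [volume_absolutelyContinuous_area.ae_le (coeFn_horoClass hΦ hf hcf)] with p hp
    rw [hp, wedge, horoForm_ey hdf, horoForm_ez hdf, horoForm_ey hdg, horoForm_ez hdg]
    ring
  have h1 : Integrable fun y => deriv f y * g y :=
    Continuous.integrable_of_hasCompactSupport (hf'.mul hg.continuous) hcg.mul_left
  have h2 : Integrable fun y => f y * deriv g y :=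
    Continuous.integrable_of_hasCompactSupport (hf.continuous.mul hg') hcg.deriv.mul_left
  have h3 : Integrable fun y => f y * g y :=
    Continuous.integrable_of_hasCompactSupport (hf.continuous.mul hg.continuous) hcg.mul_left
  have hibp := integral_mul_deriv_eq_deriv_mul_of_integrable
    (fun y _ => (hdf y).hasDerivAt) (fun y _ => (hdg y).hasDerivAt) h2 h1 h3
  rw [horoPairing_apply, e, Measure.volume_eq_prod, integral_prod_mul (μ := volume) (ν := volume)
    (fun y => deriv f y * g y - f y * deriv g y)
    (fun z => Real.smoothTransition z * deriv Real.smoothTransition z), integral_sub h1 h2, hibp,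
    integral_smoothTransition_mul_deriv]
  ring

/-! ### Disjoint bumps and linear independence -/

/-- A smooth bump function on the line centred at `5 n` and supported in `[5 n - 2, 5 n + 2]`. -/
def lineBump (n : ℕ) : ContDiffBump (5 * n : ℝ) := ⟨1, 2, one_pos, one_lt_two⟩

theorem integral_deriv_lineBump_mul_of_ne {m n : ℕ} (hmn : m ≠ n) :
    ∫ y, deriv (lineBump m) y * deriv (lineBump n) y = 0 := by
  refine integral_eq_zero_of_ae (Eventually.of_forall fun y => ?_)
  by_contra h
  have h1 : ∀ k : ℕ, deriv (lineBump k) y ≠ 0 → |y - 5 * k| ≤ 2 := fun k hk => by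
    have h2 := support_deriv_subset hk
    rw [(lineBump k).tsupport_eq] at h2
    exact h2
  have hm := abs_le.1 (h1 m (left_ne_zero_of_mul h))
  have hn := abs_le.1 (h1 n (right_ne_zero_of_mul h))
  -- A common point of the supports would put the centres within distance `4`, but distinct centres
  -- are at least `5` apart.
  rcases hmn.lt_or_gt with h' | h'
  · have : (m : ℝ) + 1 ≤ n := by exact_mod_cast h'
    linarith
  · have : (n : ℝ) + 1 ≤ m := by exact_mod_cast h'
    linarith

theorem integral_deriv_lineBump_mul_self_pos (n : ℕ) :
    0 < ∫ y, deriv (lineBump n) y * deriv (lineBump n) y := by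
  have hs : ContDiff ℝ (⊤ : ℕ∞) (lineBump n) := (lineBump n).contDiff
  have hc : Continuous (deriv (lineBump n)) := hs.continuous_deriv (by simp)
  obtain ⟨y, hy⟩ : ∃ y, deriv (lineBump n) y ≠ 0 := by
    by_contra! h
    -- The bump is `1` at its centre and `0` at distance `2`, so it is not constant.
    have h1 := is_const_of_deriv_eq_zero (hs.differentiable (by simp)) h (5 * n) (5 * n + 2)
    rw [(lineBump n).one_of_mem_closedBall (by simp [lineBump]),
      (lineBump n).zero_of_le_dist (by simp [lineBump])] at h1
    exact one_ne_zero h1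
  exact (hc.mul hc).integral_pos_of_hasCompactSupport_nonneg_nonzero
    (lineBump n).hasCompactSupport.deriv.mul_left (fun _ => mul_self_nonneg _)
    (mul_self_ne_zero.2 hy)

/-- Choosing `g_m = f_m'` turns the matrix of pairings into the `L²` Gram matrix of the derivatives
`f_n'`, which is diagonal with positive entries; rescaling the functionals gives a dual family. -/
theorem linearIndependent_reducedCohomologyOne {Φ₁ Φ₂ : NFunction}
    (hΨ₁ : Φ₁.complementary.ConditionA) (hΨ₂ : Φ₂.complementary.ConditionA)
    (hΦ₂ : Φ₂.ConditionA) :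
    ∃ v : ℕ → ReducedCohomologyOne Φ₁ Φ₂, LinearIndependent ℝ v := by
  have hs : ∀ n, ContDiff ℝ (⊤ : ℕ∞) (lineBump n) := fun n => (lineBump n).contDiff
  have hs' : ∀ n, ContDiff ℝ (⊤ : ℕ∞) (deriv (lineBump n)) := fun n =>
    (contDiff_infty_iff_deriv.1 (hs n)).2
  have hc : ∀ n, HasCompactSupport (lineBump n) := fun n => (lineBump n).hasCompactSupport
  let ℓ : ℕ → ReducedCohomologyOne Φ₁ Φ₂ →ₗ[ℝ] ℝ := fun n =>
    Submodule.liftQ _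
      ((horoPairing hΨ₂ (hs' n) (hc n).deriv).toLinearMap ∘ₗ (closedForms Φ₂).subtype)
      fun ω hω => topologicalClosure_exactForms_le_ker hΨ₁ hΨ₂ (hs' n) (hc n).deriv hω
  let v : ℕ → ReducedCohomologyOne Φ₁ Φ₂ := fun n =>
    Submodule.Quotient.mk ⟨_, horoClass_mem_closedForms hΦ₂ (hs n) (hc n)⟩
  have hv : ∀ m n, ℓ m (v n) = ∫ y, deriv (lineBump n) y * deriv (lineBump m) y := fun m n =>
    horoPairing_horoClass hΦ₂ hΨ₂ (hs n) (hc n) (hs' m) (hc m).deriv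
  refine ⟨v, LinearIndependent.of_pairwise_dual_eq_zero_one v
    (fun n => (∫ y, deriv (lineBump n) y * deriv (lineBump n) y)⁻¹ • ℓ n) ?_ ?_⟩
  · intro m n hmn
    simp only [LinearMap.smul_apply, hv, integral_deriv_lineBump_mul_of_ne hmn.symm, smul_zero]
  · intro n
    simp only [LinearMap.smul_apply, hv, smul_eq_mul]
    exact inv_mul_cancel₀ (integral_deriv_lineBump_mul_self_pos n).ne'

end HypPlane

end

/-- If `Φ₂` and the `N`-functions complementary to `Φ₁` and `Φ₂` satisfy condition (A), then the
reduced first `L_{Φ₁,Φ₂}`-cohomology of the hyperbolic plane is infinite-dimensional. -/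
theorem mainTheorem2 (Φ₁ Φ₂ : NFunction)
    (hΨ₁ : Φ₁.complementary.ConditionA)
    (hΨ₂ : Φ₂.complementary.ConditionA)
    (hΦ₂ : Φ₂.ConditionA) :
    ¬ FiniteDimensional ℝ (HypPlane.ReducedCohomologyOne Φ₁ Φ₂) := by
  intro hfin
  obtain ⟨v, hv⟩ := HypPlane.linearIndependent_reducedCohomologyOne hΨ₁ hΨ₂ hΦ₂
  have := hv.finite_of_isNoetherian
  exact not_finite ℕ
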